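/- **Regret bound for HOO.** *Environment.* Let $\mathcal X$ be a measurable space and let each arm $x\in\mathcal X$ have a reward distribution $M_x$ on $[0,1]$ with mean $f(x)$; assume that $f$ is measurable and put $f^*=\sup_{x} f(x)$. *Tree of coverings.* Nodes are pairs $(h,i)$ with $h\ge 0$, $1\le i\le 2^h$; the children of $(h,i)$ are $(h+1,2i-1)$ and $(h+1,2i)$, and $\mathcal C(h,i)$ is the set of descendants of $(h,i)$, itself included. Let $\mathcal P_{h,i}\subset\mathcal X$ be measurable sets with $\mathcal P_{0,1}=\mathcal X$ and $\mathcal P_{h,i}=\mathcal P_{h+1,2i-1}\cup\mathcal P_{h+1,2i}$. Let $\nu_1>0$ and $\rho\in(0,1)$. *HOO.* Let $(H_t,I_t)$, $X_t$, $Y_t$ be the node played, the arm played and the reward received in round $t\ge1$. Put $\mathcal T_n=\{(0,1)\}\cup\{(H_t,I_t):1\le t\le n\}$, let $T_{h,i}(n)$ be the number of $t\le n$ with $(H_t,I_t)\in\mathcal C(h,i)$, and let $\hat\mu_{h,i}(n)$ be the average of the corresponding rewards $Y_t$. Let $$U_{h,i}(n)=\hat\mu_{h,i}(n)+\sqrt{\frac{2\ln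 n}{T_{h,i}(n)}}+\nu_1\rho^h \ \text{ if } T_{h,i}(n)>0,\qquad U_{h,i}(n)=+\infty \ \text{ otherwise},$$ $$B_{h,i}(n)=\min\{U_{h,i}(n),\max\{B_{h+1,2i-1}(n),B_{h+1,2i}(n)\}\} \ \text{ if } (h,i)\in\mathcal T_n,\qquad B_{h,i}(n)=+\infty \ \text{ otherwise}.$$ In round $n+1$, HOO starts at the root $(0,1)$ and, as long as the current node lies in $\mathcal T_n$, moves to the child with the larger value $B(n)$; the first node outside $\mathcal T_n$ is $(H_{n+1},I_{n+1})$. Then HOO plays an arm $X_{n+1}\in\mathcal P_{H_{n+1},I_{n+1}}$. Ties are broken and the arm is chosen in an arbitrary, possibly random, way based on the past. Given the past, the node and the arm $X_{n+1}$, the reward $Y_{n+1}$ has law $M_{X_{n+1}}$. *Assumptions.* Let $\ell:\mathcal X^2\to[0,\infty)$ be a dissimilarity, that is, $\ell(x,x)=0$ for all $x$; write $\mathcal B(x,\epsilon)=\{y:\ell(x,y)<\epsilon\}$, and let $\nu_2>0$. (A1) For all $h\ge0$ and $1\le i\le 2^h$, $\sup_{x,y\in\mathcal P_{h,i}}\ell(x,y)\le\nu_1\rho^h$,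 and there are points $x^\circ_{h,i}\in\mathcal P_{h,i}$ such that $\mathcal B(x^\circ_{h,i},\nu_2\rho^h)\subset\mathcal P_{h,i}$ and, for each $h$, these balls are pairwise disjoint. (A2) For all $x,y\in\mathcal X$, $f^*-f(y)\le f^*-f(x)+\max\{f^*-f(x),\ell(x,y)\}$. *Near-optimality dimension.* For $A\subset\mathcal X$ let $\mathcal N(A,\ell,\epsilon)$ be the largest number (possibly $\infty$) of pairwise disjoint balls $\mathcal B(x,\epsilon)$ contained in $A$. With $\mathcal X_\epsilon=\{x:f(x)\ge f^*-\epsilon\}$ and $c=4\nu_1/\nu_2$, let $$d=\max\Bigl\{0,\ \limsup_{\epsilon\to0}\frac{\ln\mathcal N(\mathcal X_{c\epsilon},\ell,\epsilon)}{\ln(\epsilon^{-1})}\Bigr\}\in[0,\infty].$$ **Theorem.** Under (A1) and (A2), for every real $d'>d$ there is a constant $\gamma$, depending on $d'$, the parameters $\nu_1,\rho,(\mathcal P_{h,i}),\nu_2,\ell$ and the environment $M$, but not on how ties are broken and arms are chosen, such that for all $n\ge2$ the regret $R_n=n f^*-\sum_{t=1}^n f(X_t)$ is integrable and $$\mathbb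 E[R_n]\le\gamma\,n^{(d'+1)/(d'+2)}(\ln n)^{1/(d'+2)}.$$ -/

import Mathlib

open MeasureTheory Filter Topology
open scoped ENNReal

noncomputable section

namespace HOO

/-! ### Dissimilarities, packing numbers, near-optimality dimension -/

section Dissimilarity

variable {𝒳 : Type*}

/-- A dissimilarity over `𝒳`: non-negative and zero on the diagonal (no symmetry, no triangle
inequality). -/
structure IsDissimilarity (ℓ : 𝒳 → 𝒳 → ℝ) : Prop where
  nonneg : ∀ x y, 0 ≤ ℓ x y
  self : ∀ x, ℓ x x = 0

/-- The `ℓ`-diameter of a set, with value `∞` if `ℓ` is unbounded on it. -/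
def diam (ℓ : 𝒳 → 𝒳 → ℝ) (A : Set 𝒳) : ℝ≥0∞ :=
  ⨆ x ∈ A, ⨆ y ∈ A, ENNReal.ofReal (ℓ x y)

/-- The `ℓ`-open ball of `𝒳` with center `x` and radius `ε`. -/
def ball (ℓ : 𝒳 → 𝒳 → ℝ) (x : 𝒳) (ε : ℝ) : Set 𝒳 := {y | ℓ x y < ε}

/-- The `ε`-packing number of `A`: the largest number `k` (possibly `∞`) of pairwise disjoint
`ℓ`-open balls of radius `ε` that are contained in `A`. -/
def packingNumber (A : Set 𝒳) (ℓ : 𝒳 → 𝒳 → ℝ) (ε : ℝ) : ℕ∞ :=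
  ⨆ (k : ℕ) (_ : ∃ c : Fin k → 𝒳, (∀ i, ball ℓ (c i) ε ⊆ A) ∧
    ∀ i j, i ≠ j → Disjoint (ball ℓ (c i) ε) (ball ℓ (c j) ε)), (k : ℕ∞)

/-- The best value `f* = sup f`. -/
def fstar (f : 𝒳 → ℝ) : ℝ := ⨆ x, f x

/-- The set of `ε`-optimal arms. -/
def nearOptimal (f : 𝒳 → ℝ) (ε : ℝ) : Set 𝒳 := {x | fstar f - ε ≤ f x}

/-- The `c`-near-optimality dimension of `f` w.r.t. `ℓ`, as an extended real
(`ln 0 = -∞`, `ln ∞ = ∞`). -/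
def nearOptimalityDimension (c : ℝ) (f : 𝒳 → ℝ) (ℓ : 𝒳 → 𝒳 → ℝ) : EReal :=
  max 0 (limsup (fun ε : ℝ =>
    ENNReal.log ((packingNumber (nearOptimal f (c * ε)) ℓ ε : ℕ∞) : ℝ≥0∞) /
      ((Real.log ε⁻¹ : ℝ) : EReal)) (𝓝[>] (0 : ℝ)))

/-- `f` is weakly Lipschitz w.r.t. `ℓ`. -/
def WeaklyLipschitz (f : 𝒳 → ℝ) (ℓ : 𝒳 → 𝒳 → ℝ) : Prop :=
  ∀ x y, fstar f - f y ≤ fstar f - f x + max (fstar f - f x) (ℓ x y)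

end Dissimilarity

/-! ### The infinite binary tree and trees of coverings -/

/-- A node `(h, i)`: depth `h`, index `i` with `1 ≤ i ≤ 2 ^ h`. -/
abbrev Node : Type := ℕ × ℕ

/-- The root `(0, 1)`. -/
def root : Node := (0, 1)

/-- The child `(h + 1, 2 i - 1)`. -/
def left (v : Node) : Node := (v.1 + 1, 2 * v.2 - 1)

/-- The child `(h + 1, 2 i)`. -/
def right (v : Node) : Node := (v.1 + 1, 2 * v.2)

/-- The set `𝒞(v)` of the descendants of `v`, including `v`. -/
def descendants (v : Node) : Set Node :=
  {w | Relation.ReflTransGen (fun a b : Node => b = left a ∨ b = right a) v w}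

section Coverings

variable {𝒳 : Type*}

/-- `R h i` is the region of the node `(h, i)`; only the values with `1 ≤ i ≤ 2 ^ h` matter. -/
structure IsTreeOfCoverings [MeasurableSpace 𝒳] (R : ℕ → ℕ → Set 𝒳) : Prop where
  measurable : ∀ h i, 1 ≤ i → i ≤ 2 ^ h → MeasurableSet (R h i)
  root_eq : R 0 1 = Set.univ
  children : ∀ h i, 1 ≤ i → i ≤ 2 ^ h → R h i = R (h + 1) (2 * i - 1) ∪ R (h + 1) (2 * i)

/-- The regions shrink geometrically: the diameters at depth `h` are at most `ν₁ ρ ^ h`, and the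
regions at depth `h` contain pairwise disjoint balls of radius `ν₂ ρ ^ h` centered in them. -/
def ShrinksGeometrically (R : ℕ → ℕ → Set 𝒳) (ℓ : 𝒳 → 𝒳 → ℝ) (ν₁ ρ ν₂ : ℝ) : Prop :=
  (∀ h i, 1 ≤ i → i ≤ 2 ^ h → diam ℓ (R h i) ≤ ENNReal.ofReal (ν₁ * ρ ^ h)) ∧
  ∃ x₀ : ℕ → ℕ → 𝒳,
    (∀ h i, 1 ≤ i → i ≤ 2 ^ h →
      x₀ h i ∈ R h i ∧ ball ℓ (x₀ h i) (ν₂ * ρ ^ h) ⊆ R h i) ∧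
    (∀ h i j, 1 ≤ i → i < j → j ≤ 2 ^ h →
      Disjoint (ball ℓ (x₀ h i) (ν₂ * ρ ^ h)) (ball ℓ (x₀ h j) (ν₂ * ρ ^ h)))

end Coverings

/-! ### The HOO strategy

Below, `v t` is the node played in round `t ≥ 1` and `y t` the reward received in round `t ≥ 1`;
the values at `t = 0` are never used. -/

section Strategy

/-- The tree `𝒯ₙ` stored at the end of round `n`. -/
def tree (v : ℕ → Node) (n : ℕ) : Finset Node := insert root ((Finset.Icc 1 n).image v)

open Classical in
/-- The rounds `t ∈ {1, …, n}` in which a descendant of `a` was played. -/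
def visits (v : ℕ → Node) (n : ℕ) (a : Node) : Finset ℕ :=
  (Finset.Icc 1 n).filter (fun t => v t ∈ descendants a)

/-- The counter `T_a(n)`. -/
def count (v : ℕ → Node) (n : ℕ) (a : Node) : ℕ := (visits v n a).card

/-- The empirical mean `μ̂_a(n)`. -/
def empMean (v : ℕ → Node) (y : ℕ → ℝ) (n : ℕ) (a : Node) : ℝ :=
  (∑ t ∈ visits v n a, y t) / (count v n a : ℝ)

/-- The value `U_a(n)`. -/
def Uvalue (ν₁ ρ : ℝ) (v : ℕ → Node) (y : ℕ → ℝ) (n : ℕ) (a : Node) : EReal :=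
  if 0 < count v n a then
    ((empMean v y n a + Real.sqrt (2 * Real.log n / (count v n a : ℝ)) + ν₁ * ρ ^ a.1 : ℝ) : EReal)
  else ⊤

/-- The backward computation of the `B`-values from the `U`-values on a finite tree `T`. -/
def backward (T : Finset Node) (U : Node → EReal) (a : Node) : EReal :=
  if _h : a ∈ T then min (U a) (max (backward T U (left a)) (backward T U (right a))) else ⊤
termination_by T.sup Prod.fst + 1 - a.1
decreasing_by
  all_goals
    have h1 : a.1 ≤ T.sup Prod.fst := Finset.le_sup (f := Prod.fst) _h
    simp only [left, right]
    omega

/-- The value `B_a(n)`. -/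
def Bvalue (ν₁ ρ : ℝ) (v : ℕ → Node) (y : ℕ → ℝ) (n : ℕ) (a : Node) : EReal :=
  backward (tree v n) (Uvalue ν₁ ρ v y n) a

/-- One step of the traversal in round `n + 1`: from a node of `𝒯ₙ` move to a child with the
larger `B`-value; ties may be broken either way. -/
def Step (ν₁ ρ : ℝ) (v : ℕ → Node) (y : ℕ → ℝ) (n : ℕ) (a b : Node) : Prop :=
  a ∈ tree v n ∧
    ((b = left a ∧ Bvalue ν₁ ρ v y n (right a) ≤ Bvalue ν₁ ρ v y n (left a)) ∨
     (b = right a ∧ Bvalue ν₁ ρ v y n (left a) ≤ Bvalue ν₁ ρ v y n (right a)))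

/-- `b` is a node that HOO may select in round `n + 1` after the nodes `v 1, …, v n` and the
rewards `y 1, …, y n`: the traversal from the root leaves the tree `𝒯ₙ` at `b`. -/
def Selects (ν₁ ρ : ℝ) (v : ℕ → Node) (y : ℕ → ℝ) (n : ℕ) (b : Node) : Prop :=
  Relation.ReflTransGen (Step ν₁ ρ v y n) root b ∧ b ∉ tree v n

end Strategy

/-! ### Bandit environments and runs of HOO -/

section Run

variable {𝒳 : Type*} {Ω : Type*}

/-- The mean-payoff function of the environment `M`. -/
def meanPayoff (M : 𝒳 → ProbabilityMeasure ℝ) (x : 𝒳) : ℝ := ∫ y, y ∂(M x : Measure ℝ)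

/-- The information available in round `t` just before the reward is drawn: the nodes and arms of
the rounds `1, …, t` and the rewards of the rounds `1, …, t - 1`. -/
@[reducible] def info [MeasurableSpace 𝒳] (V : ℕ → Ω → Node) (X : ℕ → Ω → 𝒳) (Y : ℕ → Ω → ℝ) (t : ℕ) :
    MeasurableSpace Ω :=
  (⨆ s ∈ Finset.Icc 1 t, (MeasurableSpace.comap (V s) inferInstance ⊔
    MeasurableSpace.comap (X s) inferInstance)) ⊔
  ⨆ s ∈ Finset.Ico 1 t, MeasurableSpace.comap (Y s) inferInstance

/-- The nodes `V t`, arms `X t` and rewards `Y t` (`t ≥ 1`), random variables on the probability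
space `(Ω, ℙ)`, are produced by HOO with parameters `ν₁`, `ρ`, `R` in the environment `M`.
Tie-breaking and the choice of the arm in the selected region are arbitrary, possibly random,
functions of the past. -/
structure IsRun [MeasurableSpace 𝒳] [MeasurableSpace Ω] (M : 𝒳 → ProbabilityMeasure ℝ)
    (R : ℕ → ℕ → Set 𝒳) (ν₁ ρ : ℝ) (ℙ : Measure Ω)
    (V : ℕ → Ω → Node) (X : ℕ → Ω → 𝒳) (Y : ℕ → Ω → ℝ) : Prop where
  measurable_node : ∀ t, 1 ≤ t → Measurable (V t)
  measurable_arm : ∀ t, 1 ≤ t → Measurable (X t)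
  measurable_reward : ∀ t, 1 ≤ t → Measurable (Y t)
  /-- the node of round `n + 1` is selected by following the `B`-values of the end of round `n` -/
  node_selected : ∀ n : ℕ, ∀ᵐ ω ∂ℙ,
    Selects ν₁ ρ (fun t => V t ω) (fun t => Y t ω) n (V (n + 1) ω)
  /-- the arm lies in the region of the selected node -/
  arm_mem : ∀ t, 1 ≤ t → ∀ᵐ ω ∂ℙ, X t ω ∈ R (V t ω).1 (V t ω).2
  /-- given the past, the selected node and the arm `X t`, the reward `Y t` has law `M (X t)` -/
  reward_law : ∀ t, 1 ≤ t → ∀ g : ℝ → ℝ, Measurable g → (∃ C, ∀ y, |g y| ≤ C) →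
    ℙ[fun ω => g (Y t ω) | info V X Y t] =ᵐ[ℙ] fun ω => ∫ y, g y ∂(M (X t ω) : Measure ℝ)

/-- The cumulative (pseudo-)regret `Rₙ = n f* - ∑_{t=1}^n f(X_t)`. -/
def regret (f : 𝒳 → ℝ) (X : ℕ → Ω → 𝒳) (n : ℕ) (ω : Ω) : ℝ :=
  n * fstar f - ∑ t ∈ Finset.Icc 1 n, f (X t ω)

end Run

end HOO

end

/-! The proof is optimism on a tree. Some infinite path from the root consists of nodes on whose
regions `f` has supremum f*. By (A1) and (A2) every arm in such a region at depth h is within ν₁ρ^h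
of f*, so in the absence of large deviations all `U`-values on the path exceed f*
(`fstar_lt_Uvalue`). Outside the stored tree `B` is +∞, so this lower bound climbs up the path to
the root; it then descends with the traversal, along which `B` never decreases
(`lt_Uvalue_of_selects`). Hence every node that the traversal passes has `U` > f*. A node at depth h
whose supremum is below f* - 2ν₁ρ^h cannot satisfy this after more than 8 ln n/(ν₁ρ^h)² visits,
unless its own noise deviates, so its expected number of visits is O(ln n/ρ^(2h))
(`IsRun.integral_count_le`). The deviations are controlled by an exponential supermartingale and a
union bound over the random number of visits (`IsRun.measureReal_largeDeviation_le`).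

To sum up the regret, cut the tree at depth H. A played node lies below a near-optimal node of depth
H, or is itself a near-optimal node of depth h < H, which is played at most once, or lies below a
suboptimal child of such a node (`node_trichotomy`). A round costs at most 4ν₁ρ^H in the first case
and 4ν₁ρ^h in the others. Near-optimal nodes of depth h contain disjoint balls of radius ν₂ρ^h made
of 4ν₁ρ^h-optimal arms, so there are O(ρ^(-hd')) of them (`exists_card_nearOptimalNodes_le`). The
total is of order nρ^H + ln n · ∑_{h<H} ρ^(-h(1+d')), and ρ^H ≈ (ln n/n)^(1/(d'+2)) balances both
terms (`exists_depth_bound`). -/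

namespace HOO

/-! ### The binary tree -/

/-- `b` is one of the two children of `a`. -/
def IsChild (a b : Node) : Prop := b = left a ∨ b = right a

theorem mem_descendants {a b : Node} :
    b ∈ descendants a ↔ Relation.ReflTransGen IsChild a b := Iff.rfl

theorem self_mem_descendants (a : Node) : a ∈ descendants a := Relation.ReflTransGen.refl

theorem IsChild.depth {a b : Node} (h : IsChild a b) : b.1 = a.1 + 1 := by
  rcases h with rfl | rfl <;> rfl

theorem IsChild.mem_descendants {a b c : Node} (h : IsChild b c) (hb : b ∈ descendants a) :
    c ∈ descendants a := Relation.ReflTransGen.tail hb h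

theorem depth_le_of_mem_descendants {a b : Node} (h : b ∈ descendants a) : a.1 ≤ b.1 := by
  rw [mem_descendants] at h
  induction h with
  | refl => exact le_rfl
  | tail _ h ih => have := h.depth; omega

theorem index_bounds {a : Node} (h : a ∈ descendants root) : 1 ≤ a.2 ∧ a.2 ≤ 2 ^ a.1 := by
  rw [mem_descendants] at h
  induction h with
  | refl => simp [root]
  | tail _ h ih =>
    rcases h with rfl | rfl <;> simp only [left, right, pow_succ] <;> omega

theorem IsChild.parent_unique {a a' b : Node} (ha : 1 ≤ a.2) (ha' : 1 ≤ a'.2)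
    (h : IsChild a b) (h' : IsChild a' b) : a = a' := by
  rcases h with h | h <;> rcases h' with h' | h' <;> rw [h] at h' <;>
    simp only [left, right, Prod.mk.injEq] at h' <;> ext <;> omega

/-- A path that starts at the root and follows parent-child edges visits all ancestors of its
endpoint. -/
theorem path_through_ancestor {S : Node → Node → Prop} (hS : ∀ a b, S a b → IsChild a b)
    {a b : Node} (ha : a ∈ descendants root) (hb : b ∈ descendants a)
    (hpath : Relation.ReflTransGen S root b) :
    Relation.ReflTransGen S root a ∧ Relation.ReflTransGen S a b := by
  induction hpath with
  | refl =>
    have : a = root := by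
      rcases Relation.ReflTransGen.cases_tail ha with h | ⟨c, -, hc⟩
      · exact h
      · have h1 := IsChild.depth hc
        have h2 := depth_le_of_mem_descendants hb
        simp only [root] at h2
        omega
    subst this
    exact ⟨.refl, .refl⟩
  | @tail c b hc hcb ih =>
    rcases Relation.ReflTransGen.cases_tail hb with h | ⟨c', hc', hcb'⟩
    · subst h
      exact ⟨hc.tail hcb, .refl⟩
    · have hcr : c ∈ descendants root := Relation.ReflTransGen.mono hS _ _ hc
      have hcr' : c' ∈ descendants root := Relation.ReflTransGen.trans ha hc'
      -- Parents are unique, so the last edge of the path is also the last edge of the descent from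
      -- `a`.
      have : c = c' := IsChild.parent_unique (index_bounds hcr).1 (index_bounds hcr').1
        (hS _ _ hcb) hcb'
      subst this
      obtain ⟨h1, h2⟩ := ih hc'
      exact ⟨h1, h2.tail hcb⟩

/-! ### The traversal -/

section Traversal

variable {ν₁ ρ : ℝ} {v : ℕ → Node} {y : ℕ → ℝ}

theorem Step.isChild {n : ℕ} {a b : Node} (h : Step ν₁ ρ v y n a b) : IsChild a b := by
  rcases h.2 with h | h
  · exact .inl h.1
  · exact .inr h.1

theorem Selects.mem_descendants {n : ℕ} {b : Node} (h : Selects ν₁ ρ v y n b) :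
    b ∈ descendants root := Relation.ReflTransGen.mono (fun _ _ => Step.isChild) _ _ h.1

theorem tree_mono {m n : ℕ} (h : m ≤ n) : tree v m ⊆ tree v n := by
  unfold tree
  exact Finset.insert_subset_insert _ (Finset.image_subset_image (Finset.Icc_subset_Icc_right h))

theorem mem_tree {n : ℕ} {a : Node} :
    a ∈ tree v n ↔ a = root ∨ ∃ t, (1 ≤ t ∧ t ≤ n) ∧ v t = a := by
  simp [tree]

/-- The traversal passes through every ancestor of its endpoint, and it only moves on from nodes
that are already stored. -/
theorem Selects.descendant_step {n : ℕ} {a b : Node} (h : Selects ν₁ ρ v y n b)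
    (ha : a ∈ descendants root) (hb : b ∈ descendants a) :
    Relation.ReflTransGen (Step ν₁ ρ v y n) root a ∧ (a = b ∨ a ∈ tree v n) := by
  obtain ⟨h1, h2⟩ := path_through_ancestor (fun _ _ => Step.isChild) ha hb h.1
  refine ⟨h1, ?_⟩
  rcases Relation.ReflTransGen.cases_head h2 with h | ⟨c, hc, -⟩
  · exact .inl h
  · exact .inr hc.1

/-- The stored tree is closed under ancestors, so the recursion `B` ≤ `U` applies to every node with
a positive counter. -/
theorem mem_tree_of_mem_descendants (hsel : ∀ n, Selects ν₁ ρ v y n (v (n + 1)))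
    {n t : ℕ} (ht1 : 1 ≤ t) (htn : t ≤ n) {a : Node} (ha : a ∈ descendants root)
    (h : v t ∈ descendants a) : a ∈ tree v n := by
  obtain ⟨s, rfl⟩ : ∃ s, t = s + 1 := ⟨t - 1, by omega⟩
  rcases ((hsel s).descendant_step ha h).2 with h | h
  · exact mem_tree.2 (.inr ⟨s + 1, ⟨ht1, htn⟩, h.symm⟩)
  · exact tree_mono (by omega) h

/-- Each new node is the root or a child of a stored node, so the depth grows by at most one per
round. This later limits the union bound over the infinite optimal path to finitely many nodes. -/
theorem depth_node_le (hsel : ∀ n, Selects ν₁ ρ v y n (v (n + 1))) (t : ℕ) (ht : 1 ≤ t) :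
    (v t).1 ≤ t := by
  induction t using Nat.strong_induction_on with
  | _ t ih =>
    obtain ⟨s, rfl⟩ : ∃ s, t = s + 1 := ⟨t - 1, by omega⟩
    rcases Relation.ReflTransGen.cases_tail (hsel s).1 with h | ⟨c, -, hc⟩
    · rw [h]; simp [root]
    · rw [hc.isChild.depth]
      rcases mem_tree.1 hc.1 with rfl | ⟨r, ⟨hr1, hrs⟩, rfl⟩
      · simp [root]
      · have := ih r (by omega) hr1
        omega

theorem node_injective (hsel : ∀ n, Selects ν₁ ρ v y n (v (n + 1))) {s t : ℕ} (hs : 1 ≤ s)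
    (ht : 1 ≤ t) (h : v s = v t) : s = t := by
  have key : ∀ s t, 1 ≤ s → s < t → v s ≠ v t := by
    intro s t hs hst h
    obtain ⟨r, rfl⟩ : ∃ r, t = r + 1 := ⟨t - 1, by omega⟩
    exact (hsel r).2 (mem_tree.2 (.inr ⟨s, ⟨hs, by omega⟩, h⟩))
  rcases lt_trichotomy s t with h' | h' | h'
  · exact (key s t hs h' h).elim
  · exact h'
  · exact (key t s ht h' h.symm).elim

theorem mem_visits {n t : ℕ} {a : Node} :
    t ∈ visits v n a ↔ (1 ≤ t ∧ t ≤ n) ∧ v t ∈ descendants a := by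
  simp [visits]

theorem visits_zero (a : Node) : visits v 0 a = ∅ := by
  ext t; rw [mem_visits]; simp; omega

theorem count_zero (a : Node) : count v 0 a = 0 := by simp [count, visits_zero]

theorem visits_succ_of_mem {n : ℕ} {a : Node} (h : v (n + 1) ∈ descendants a) :
    visits v (n + 1) a = insert (n + 1) (visits v n a) := by
  ext t
  simp only [Finset.mem_insert, mem_visits]
  constructor
  · rintro ⟨⟨h1, h2⟩, h3⟩
    by_cases ht : t = n + 1
    · exact .inl ht
    · exact .inr ⟨⟨h1, by omega⟩, h3⟩
  · rintro (rfl | ⟨⟨h1, h2⟩, h3⟩)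
    · exact ⟨⟨by omega, le_rfl⟩, h⟩
    · exact ⟨⟨h1, by omega⟩, h3⟩

theorem visits_succ_of_notMem {n : ℕ} {a : Node} (h : v (n + 1) ∉ descendants a) :
    visits v (n + 1) a = visits v n a := by
  ext t
  simp only [mem_visits]
  constructor
  · rintro ⟨⟨h1, h2⟩, h3⟩
    by_cases ht : t = n + 1
    · subst ht; exact (h h3).elim
    · exact ⟨⟨h1, by omega⟩, h3⟩
  · rintro ⟨⟨h1, h2⟩, h3⟩
    exact ⟨⟨h1, by omega⟩, h3⟩

theorem notMem_visits_self (n : ℕ) (a : Node) : n + 1 ∉ visits v n a := by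
  rw [mem_visits]; omega

theorem count_succ_of_mem {n : ℕ} {a : Node} (h : v (n + 1) ∈ descendants a) :
    count v (n + 1) a = count v n a + 1 := by
  rw [count, visits_succ_of_mem h, Finset.card_insert_of_notMem (notMem_visits_self n a), count]

theorem count_succ_of_notMem {n : ℕ} {a : Node} (h : v (n + 1) ∉ descendants a) :
    count v (n + 1) a = count v n a := by
  rw [count, visits_succ_of_notMem h, count]

theorem count_le (n : ℕ) (a : Node) : count v n a ≤ n := by
  induction n with
  | zero => simp [count_zero]
  | succ n ih =>
    by_cases h : v (n + 1) ∈ descendants a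
    · rw [count_succ_of_mem h]; omega
    · rw [count_succ_of_notMem h]; omega

theorem count_eq_zero_of_depth (hsel : ∀ n, Selects ν₁ ρ v y n (v (n + 1))) {n : ℕ} {a : Node}
    (h : n < a.1) : count v n a = 0 := by
  rw [count, Finset.card_eq_zero, Finset.eq_empty_iff_forall_notMem]
  intro t ht
  rw [mem_visits] at ht
  have h1 := depth_node_le hsel t ht.1.1
  have h2 := depth_le_of_mem_descendants ht.2
  omega

/-- If only visits with more than `u` past visits are flagged, then the number of visits is at most
`u + 1` plus the number of flags. -/
theorem count_le_add_sum_indicator (a : Node) {u : ℝ} (hu : 0 ≤ u) (bad : ℕ → Prop)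
    [DecidablePred bad] (n : ℕ)
    (h : ∀ t < n, v (t + 1) ∈ descendants a → u < count v t a → bad t) :
    (count v n a : ℝ) ≤ u + 1 + ∑ t ∈ Finset.range n, if bad t then (1 : ℝ) else 0 := by
  induction n with
  | zero => simp [count_zero]; linarith
  | succ n ih =>
    have ih := ih fun t ht => h t (by omega)
    have h0 : (0 : ℝ) ≤ ∑ t ∈ Finset.range n, if bad t then (1 : ℝ) else 0 :=
      Finset.sum_nonneg fun t _ => by split_ifs <;> norm_num
    have h1 : (0 : ℝ) ≤ if bad n then (1 : ℝ) else 0 := by split_ifs <;> norm_num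
    rw [Finset.sum_range_succ]
    by_cases hm : v (n + 1) ∈ descendants a
    · rw [count_succ_of_mem hm]
      push_cast
      by_cases hc : u < count v n a
      · rw [if_pos (h n (by omega) hm hc)]
        linarith
      -- Below the threshold the new count is at most `u + 1` outright, whatever happened before.
      · linarith [not_lt.1 hc]
    · rw [count_succ_of_notMem hm]
      linarith

theorem Bvalue_eq (n : ℕ) (a : Node) :
    Bvalue ν₁ ρ v y n a = if a ∈ tree v n then
      min (Uvalue ν₁ ρ v y n a) (max (Bvalue ν₁ ρ v y n (left a)) (Bvalue ν₁ ρ v y n (right a)))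
      else ⊤ := by
  unfold Bvalue
  rw [backward]
  simp only [dite_eq_ite]

/-- A bound on the `U`-values along an infinite path bounds its `B`-values. -/
theorem lt_Bvalue_of_path {n : ℕ} {z : EReal} (hz : z < ⊤) {o : ℕ → Node}
    (ho : ∀ s, IsChild (o s) (o (s + 1))) (hU : ∀ s, z < Uvalue ν₁ ρ v y n (o s)) (s : ℕ) :
    z < Bvalue ν₁ ρ v y n (o s) := by
  have hdepth : ∀ s, s ≤ (o s).1 := by
    intro s
    induction s with
    | zero => simp
    | succ s ih => rw [(ho s).depth]; omega
  -- Backward induction along the path, starting beyond the deepest stored node, where `B` is `⊤`.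
  have key : ∀ k s, (tree v n).sup Prod.fst + 1 ≤ s + k → z < Bvalue ν₁ ρ v y n (o s) := by
    intro k
    induction k with
    | zero =>
      intro s hs
      have : o s ∉ tree v n := fun h => by
        have h1 : (o s).1 ≤ (tree v n).sup Prod.fst := Finset.le_sup (f := Prod.fst) h
        have := hdepth s
        omega
      rw [Bvalue_eq, if_neg this]
      exact hz
    | succ k ih =>
      intro s hs
      rw [Bvalue_eq]
      split_ifs with h
      · have h1 := ih (s + 1) (by omega)
        refine lt_min (hU s) (lt_max_iff.2 ?_)
        rcases ho s with h2 | h2 <;> rw [h2] at h1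
        · exact .inl h1
        · exact .inr h1
      · exact hz
  exact key _ s le_add_self

/-- The traversal moves to the child attaining the maximum in the recursion for `B`, so optimism at
the root is inherited all the way down. -/
theorem Step.Bvalue_le {n : ℕ} {a b : Node} (h : Step ν₁ ρ v y n a b) :
    Bvalue ν₁ ρ v y n a ≤ Bvalue ν₁ ρ v y n b := by
  rw [Bvalue_eq, if_pos h.1]
  refine (min_le_right _ _).trans ?_
  rcases h.2 with ⟨rfl, h'⟩ | ⟨rfl, h'⟩
  · exact max_le le_rfl h'
  · exact max_le h' le_rfl

/-- If all `U`-values on an infinite path from the root exceed `z`, then so do the `U`-values of all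
nodes above a selected node. -/
theorem lt_Uvalue_of_selects (hsel : ∀ n, Selects ν₁ ρ v y n (v (n + 1))) {n : ℕ} {z : EReal}
    (hz : z < ⊤) {o : ℕ → Node} (ho0 : o 0 = root) (ho : ∀ s, IsChild (o s) (o (s + 1)))
    (hU : ∀ s, z < Uvalue ν₁ ρ v y n (o s)) {a : Node} (ha : a ∈ descendants root)
    (hva : v (n + 1) ∈ descendants a) : z < Uvalue ν₁ ρ v y n a := by
  have hpath := ((hsel n).descendant_step ha hva).1
  have hB : z < Bvalue ν₁ ρ v y n a := by
    have h0 : z < Bvalue ν₁ ρ v y n root := ho0 ▸ lt_Bvalue_of_path hz ho hU 0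
    clear hva ha
    induction hpath with
    | refl => exact h0
    | tail _ h ih => exact ih.trans_le h.Bvalue_le
  -- A visited node is stored, so `B` ≤ `U` there; an unvisited one has `U` = `⊤`.
  by_cases hc : 0 < count v n a
  · obtain ⟨t, ht⟩ := Finset.card_pos.1 hc
    rw [mem_visits] at ht
    have := mem_tree_of_mem_descendants hsel ht.1.1 ht.1.2 ha ht.2
    rw [Bvalue_eq, if_pos this] at hB
    exact hB.trans_le (min_le_left _ _)
  · rw [Uvalue, if_neg hc]
    exact hz

end Traversal

/-! ### Near-optimal nodes -/

section NearOptimalNodes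

variable {𝒳 : Type*}

/-- The supremum of `f` on the region of the node `a` is at least `f* - c`. -/
def IsNearOptimalNode (f : 𝒳 → ℝ) (R : ℕ → ℕ → Set 𝒳) (a : Node) (c : ℝ) : Prop :=
  ∀ η > 0, ∃ x ∈ R a.1 a.2, fstar f - f x < c + η

variable {f : 𝒳 → ℝ} {R : ℕ → ℕ → Set 𝒳} {ℓ : 𝒳 → 𝒳 → ℝ} {ν₁ ρ ν₂ : ℝ}

theorem IsNearOptimalNode.mono {a : Node} {c c' : ℝ} (h : IsNearOptimalNode f R a c)
    (hc : c ≤ c') : IsNearOptimalNode f R a c' := fun η hη => by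
  obtain ⟨x, hx, h⟩ := h η hη
  exact ⟨x, hx, by linarith⟩

theorem le_of_not_isNearOptimalNode {a : Node} {c : ℝ} (h : ¬ IsNearOptimalNode f R a c) {x : 𝒳}
    (hx : x ∈ R a.1 a.2) : f x ≤ fstar f - c := by
  unfold IsNearOptimalNode at h
  push Not at h
  obtain ⟨η, hη, h⟩ := h
  linarith [h x hx]

theorem IsTreeOfCoverings.region_eq [MeasurableSpace 𝒳] (hR : IsTreeOfCoverings R) {a : Node}
    (ha : a ∈ descendants root) :
    R a.1 a.2 = R (left a).1 (left a).2 ∪ R (right a).1 (right a).2 :=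
  hR.children a.1 a.2 (index_bounds ha).1 (index_bounds ha).2

theorem IsTreeOfCoverings.region_child_subset [MeasurableSpace 𝒳] (hR : IsTreeOfCoverings R)
    {a b : Node} (ha : a ∈ descendants root) (h : IsChild a b) : R b.1 b.2 ⊆ R a.1 a.2 := by
  rw [hR.region_eq ha]
  rcases h with rfl | rfl
  · exact Set.subset_union_left
  · exact Set.subset_union_right

theorem IsTreeOfCoverings.region_subset [MeasurableSpace 𝒳] (hR : IsTreeOfCoverings R)
    {a b : Node} (ha : a ∈ descendants root) (h : b ∈ descendants a) : R b.1 b.2 ⊆ R a.1 a.2 := by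
  rw [mem_descendants] at h
  induction h with
  | refl => exact subset_rfl
  | tail h1 h2 ih => exact (hR.region_child_subset (Relation.ReflTransGen.trans ha h1) h2).trans ih

/-- The supremum over a region is the larger of the suprema over the two child regions that cover
it. -/
theorem IsNearOptimalNode.exists_child [MeasurableSpace 𝒳] (hR : IsTreeOfCoverings R)
    {a : Node} (ha : a ∈ descendants root) {c : ℝ} (h : IsNearOptimalNode f R a c) :
    ∃ b, IsChild a b ∧ IsNearOptimalNode f R b c := by
  by_contra! hcon
  have h1 := hcon _ (.inl rfl)
  have h2 := hcon _ (.inr rfl)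
  unfold IsNearOptimalNode at h1 h2
  push Not at h1 h2
  obtain ⟨η₁, hη₁, h1⟩ := h1
  obtain ⟨η₂, hη₂, h2⟩ := h2
  obtain ⟨x, hx, hlt⟩ := h (min η₁ η₂) (lt_min hη₁ hη₂)
  rw [hR.region_eq ha] at hx
  rcases hx with hx | hx
  · linarith [h1 x hx, min_le_left η₁ η₂]
  · linarith [h2 x hx, min_le_right η₁ η₂]

theorem isNearOptimalNode_root [MeasurableSpace 𝒳] [Nonempty 𝒳] (hR : IsTreeOfCoverings R) :
    IsNearOptimalNode f R root 0 := fun η hη => by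
  obtain ⟨x, hx⟩ := exists_lt_of_lt_ciSup (show fstar f - η < ⨆ x, f x by
    change _ < fstar f; linarith)
  exact ⟨x, by simp [root, hR.root_eq], by linarith⟩

/-- There is an infinite path of nodes on whose regions `f` has supremum `f*`. -/
theorem exists_optimal_path [MeasurableSpace 𝒳] [Nonempty 𝒳] (hR : IsTreeOfCoverings R)
    (f : 𝒳 → ℝ) : ∃ o : ℕ → Node, o 0 = root ∧ (∀ s, IsChild (o s) (o (s + 1))) ∧
      ∀ s, o s ∈ descendants root ∧ (o s).1 = s ∧ IsNearOptimalNode f R (o s) 0 := by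
  let T := {a : Node // a ∈ descendants root ∧ IsNearOptimalNode f R a 0}
  have hT : ∀ a : T, ∃ b : T, IsChild a.1 b.1 := fun a => by
    obtain ⟨b, hb, hb'⟩ := a.2.2.exists_child hR a.2.1
    exact ⟨⟨b, hb.mem_descendants a.2.1, hb'⟩, hb⟩
  choose g hg using hT
  let o : ℕ → T := fun s =>
    Nat.rec ⟨root, self_mem_descendants root, isNearOptimalNode_root hR⟩ (fun _ a => g a) s
  refine ⟨fun s => (o s).1, rfl, fun s => hg (o s), fun s => ⟨(o s).2.1, ?_, (o s).2.2⟩⟩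
  induction s with
  | zero => rfl
  | succ s ih => exact (hg (o s)).depth.trans (by rw [ih])

theorem ShrinksGeometrically.dissimilarity_le (h : ShrinksGeometrically R ℓ ν₁ ρ ν₂)
    (hν₁ : 0 < ν₁) (hρ : 0 < ρ) {a : Node} (ha : a ∈ descendants root) {x y : 𝒳}
    (hx : x ∈ R a.1 a.2) (hy : y ∈ R a.1 a.2) : ℓ x y ≤ ν₁ * ρ ^ a.1 := by
  have h1 := h.1 a.1 a.2 (index_bounds ha).1 (index_bounds ha).2
  have h2 : ENNReal.ofReal (ℓ x y) ≤ diam ℓ (R a.1 a.2) := by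
    unfold diam
    exact le_iSup₂_of_le x hx (le_iSup₂_of_le y hy le_rfl)
  exact (ENNReal.ofReal_le_ofReal_iff (by positivity)).1 (h2.trans h1)

/-- All arms in the region of a near-optimal node are near-optimal. -/
theorem IsNearOptimalNode.fstar_sub_le (hA1 : ShrinksGeometrically R ℓ ν₁ ρ ν₂)
    (hA2 : WeaklyLipschitz f ℓ) (hν₁ : 0 < ν₁) (hρ : 0 < ρ) {a : Node}
    (ha : a ∈ descendants root) {c : ℝ} (h : IsNearOptimalNode f R a c) {y : 𝒳}
    (hy : y ∈ R a.1 a.2) : fstar f - f y ≤ c + max c (ν₁ * ρ ^ a.1) := by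
  refine le_of_forall_pos_le_add fun η hη => ?_
  -- The supremum need not be attained. The slack of a near-maximiser enters (A2) twice, hence `η /
  -- 2`.
  obtain ⟨x, hx, hlt⟩ := h (η / 2) (by linarith)
  have h1 := hA2 x y
  have h2 := hA1.dissimilarity_le hν₁ hρ ha hx hy
  have h3 : max (fstar f - f x) (ℓ x y) ≤ max c (ν₁ * ρ ^ a.1) + η / 2 :=
    max_le (by linarith [le_max_left c (ν₁ * ρ ^ a.1)])
      (by linarith [le_max_right c (ν₁ * ρ ^ a.1)])
  linarith

end NearOptimalNodes

/-! ### Concentration of the noise at a node -/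

section Concentration

variable {𝒳 : Type*} {Ω : Type*}

theorem meanPayoff_mem_Icc {M : 𝒳 → ProbabilityMeasure ℝ}
    (hM : ∀ x, (M x : Measure ℝ) (Set.Icc 0 1)ᶜ = 0) (x : 𝒳) :
    meanPayoff M x ∈ Set.Icc (0 : ℝ) 1 := by
  have h : ∀ᵐ y ∂(M x : Measure ℝ), y ∈ Set.Icc (0 : ℝ) 1 := hM x
  have hint : Integrable (fun y : ℝ => y) (M x : Measure ℝ) :=
    Integrable.of_mem_Icc 0 1 measurable_id.aemeasurable h
  constructor
  · exact integral_nonneg_of_ae (h.mono fun y hy => hy.1)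
  · have := integral_mono_ae hint (integrable_const (1 : ℝ)) (h.mono fun y hy => hy.2)
    simpa [meanPayoff] using this

/-- Hoeffding's lemma for the reward distributions. -/
theorem integral_exp_reward_le {M : 𝒳 → ProbabilityMeasure ℝ}
    (hM : ∀ x, (M x : Measure ℝ) (Set.Icc 0 1)ᶜ = 0) (x : 𝒳) (r : ℝ) :
    ∫ y, Real.exp (r * max 0 (min 1 y)) ∂(M x : Measure ℝ) ≤
      Real.exp (r * meanPayoff M x + r ^ 2 / 8) := by
  have h : ∀ᵐ y ∂(M x : Measure ℝ), y ∈ Set.Icc (0 : ℝ) 1 := hM x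
  have h1 := (ProbabilityTheory.hasSubgaussianMGF_of_mem_Icc (μ := (M x : Measure ℝ))
    (X := fun y : ℝ => y) measurable_id.aemeasurable h).mgf_le r
  -- The clamp makes the exponential bounded, as `reward_law` requires of its test functions; it
  -- changes nothing on [0,1].
  have h2 : ∫ y, Real.exp (r * max 0 (min 1 y)) ∂(M x : Measure ℝ) =
      Real.exp (r * meanPayoff M x) *
        ProbabilityTheory.mgf (fun y : ℝ => y - ∫ y, y ∂(M x : Measure ℝ)) (M x : Measure ℝ) r := by
    rw [ProbabilityTheory.mgf, ← integral_const_mul]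
    refine integral_congr_ae (h.mono fun y hy => ?_)
    simp only
    rw [min_eq_right hy.2, max_eq_right hy.1, ← Real.exp_add]
    congr 1
    simp only [meanPayoff]
    ring
  rw [h2, Real.exp_add]
  refine mul_le_mul_of_nonneg_left (h1.trans_eq ?_) (Real.exp_pos _).le
  congr 1
  norm_num
  ring

variable {M : 𝒳 → ProbabilityMeasure ℝ} {V : ℕ → Ω → Node} {X : ℕ → Ω → 𝒳} {Y : ℕ → Ω → ℝ}

open Classical in
/-- The exponent of the supermartingale attached to the node `a`: the sum, over the visits of `a`
up to round `n`, of the `r`-scaled noise, compensated by the bound of Hoeffding's lemma. -/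
noncomputable def compensatedNoise (M : 𝒳 → ProbabilityMeasure ℝ) (V : ℕ → Ω → Node)
    (X : ℕ → Ω → 𝒳) (Y : ℕ → Ω → ℝ) (a : Node) (r : ℝ) (n : ℕ) (ω : Ω) : ℝ :=
  ∑ t ∈ Finset.Icc 1 n, if V t ω ∈ descendants a then
    r * (Y t ω - meanPayoff M (X t ω)) - r ^ 2 / 8 else 0

/-- The total noise of the rewards received in the descendants of `a`. -/
noncomputable def noise (M : 𝒳 → ProbabilityMeasure ℝ) (v : ℕ → Node) (x : ℕ → 𝒳) (y : ℕ → ℝ)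
    (n : ℕ) (a : Node) : ℝ := ∑ t ∈ visits v n a, (y t - meanPayoff M (x t))

/-- The compensator is proportional to the number of visits: once that number is fixed to j, the
exponent can be tuned by choosing `r` in terms of j. -/
theorem compensatedNoise_eq (a : Node) (r : ℝ) (n : ℕ) (ω : Ω) :
    compensatedNoise M V X Y a r n ω =
      r * noise M (fun t => V t ω) (fun t => X t ω) (fun t => Y t ω) n a -
        r ^ 2 / 8 * count (fun t => V t ω) n a := by
  classical
  unfold compensatedNoise noise count visits
  rw [← Finset.sum_filter, Finset.sum_sub_distrib, Finset.mul_sum, Finset.sum_const, nsmul_eq_mul]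
  rw [mul_comm (r ^ 2 / 8)]

variable [MeasurableSpace 𝒳]

/-- The σ-algebra `m` is free because the result is needed both for the ambient one and for the
information before the next reward. -/
theorem measurable_compensatedNoise {m : MeasurableSpace Ω} (hf : Measurable (meanPayoff M)) {n : ℕ}
    (hV : ∀ t ∈ Finset.Icc 1 n, Measurable[m] (V t)) (hX : ∀ t ∈ Finset.Icc 1 n, Measurable[m] (X t))
    (hY : ∀ t ∈ Finset.Icc 1 n, Measurable[m] (Y t)) (a : Node) (r : ℝ) :
    Measurable[m] (compensatedNoise M V X Y a r n) := by
  unfold compensatedNoise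
  refine Finset.measurable_fun_sum _ fun t ht => ?_
  refine Measurable.ite ((hV t ht) (Set.to_countable _).measurableSet) ?_ measurable_const
  exact (((hY t ht).sub (hf.comp (hX t ht))).const_mul r).sub_const _

theorem measurable_info_node {s t : ℕ} (hs : s ∈ Finset.Icc 1 t) :
    Measurable[info V X Y t] (V s) :=
  Measurable.of_comap_le (le_sup_of_le_left (le_iSup₂_of_le s hs le_sup_left))

theorem measurable_info_arm {s t : ℕ} (hs : s ∈ Finset.Icc 1 t) :
    Measurable[info V X Y t] (X s) :=
  Measurable.of_comap_le (le_sup_of_le_left (le_iSup₂_of_le s hs le_sup_right))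

theorem measurable_info_reward {s t : ℕ} (hs : s ∈ Finset.Ico 1 t) :
    Measurable[info V X Y t] (Y s) :=
  Measurable.of_comap_le (le_sup_of_le_right (le_iSup₂_of_le s hs le_rfl))

variable [mΩ : MeasurableSpace Ω] {R : ℕ → ℕ → Set 𝒳} {ν₁ ρ : ℝ} {ℙ : Measure Ω}

theorem IsRun.info_le (h : IsRun M R ν₁ ρ ℙ V X Y) (t : ℕ) : info V X Y t ≤ mΩ := by
  refine sup_le (iSup₂_le fun s hs => sup_le ?_ ?_) (iSup₂_le fun s hs => ?_)
  · exact (h.measurable_node s (Finset.mem_Icc.1 hs).1).comap_le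
  · exact (h.measurable_arm s (Finset.mem_Icc.1 hs).1).comap_le
  · exact (h.measurable_reward s (Finset.mem_Ico.1 hs).1).comap_le

variable [IsProbabilityMeasure ℙ]

/-- Test the conditional law against the indicator of the complement of [0,1] and integrate. -/
theorem IsRun.ae_reward_mem (h : IsRun M R ν₁ ρ ℙ V X Y)
    (hM : ∀ x, (M x : Measure ℝ) (Set.Icc 0 1)ᶜ = 0) {t : ℕ} (ht : 1 ≤ t) :
    ∀ᵐ ω ∂ℙ, Y t ω ∈ Set.Icc (0 : ℝ) 1 := by
  set g : ℝ → ℝ := (Set.Icc (0 : ℝ) 1)ᶜ.indicator 1 with hg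
  have hgm : Measurable g := measurable_one.indicator measurableSet_Icc.compl
  have hg0 : ∀ y, 0 ≤ g y := fun y => Set.indicator_nonneg (fun _ _ => zero_le_one) y
  have hg1 : ∀ y, |g y| ≤ 1 := fun y => by
    rw [abs_of_nonneg (hg0 y)]
    exact Set.indicator_le_self' (fun _ _ => zero_le_one) y
  have hlaw := h.reward_law t ht g hgm ⟨1, hg1⟩
  have hint : Integrable (fun ω => g (Y t ω)) ℙ :=
    Integrable.of_bound (hgm.comp (h.measurable_reward t ht)).aestronglyMeasurable 1
      (ae_of_all _ fun ω => hg1 _)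
  have h0 : ∫ ω, g (Y t ω) ∂ℙ = 0 := by
    rw [← integral_condExp (h.info_le t), integral_congr_ae hlaw]
    refine integral_eq_zero_of_ae (ae_of_all _ fun ω => ?_)
    simp [hg, integral_indicator measurableSet_Icc.compl, hM, Measure.real]
  have h1 := (integral_eq_zero_iff_of_nonneg (fun ω => hg0 _) hint).1 h0
  filter_upwards [h1] with ω hω
  by_contra hcon
  simp [hg, Set.indicator_of_mem (Set.mem_compl hcon)] at hω

theorem IsRun.ae_abs_compensatedNoise_le (h : IsRun M R ν₁ ρ ℙ V X Y)
    (hM : ∀ x, (M x : Measure ℝ) (Set.Icc 0 1)ᶜ = 0) (a : Node) (r : ℝ) (n : ℕ) :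
    ∀ᵐ ω ∂ℙ, |compensatedNoise M V X Y a r n ω| ≤ n * (|r| + r ^ 2 / 8) := by
  have h1 : ∀ᵐ ω ∂ℙ, ∀ t, 1 ≤ t → Y t ω ∈ Set.Icc (0 : ℝ) 1 :=
    ae_all_iff.2 fun t => Filter.eventually_imp_distrib_left.2 fun ht => h.ae_reward_mem hM ht
  filter_upwards [h1] with ω hω
  unfold compensatedNoise
  refine (Finset.abs_sum_le_sum_abs _ _).trans ?_
  refine (Finset.sum_le_card_nsmul _ _ (|r| + r ^ 2 / 8) fun t ht => ?_).trans_eq (by simp [mul_add])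
  split_ifs
  · have h2 := hω t (Finset.mem_Icc.1 ht).1
    have h3 := meanPayoff_mem_Icc hM (X t ω)
    refine (abs_sub _ _).trans ?_
    rw [abs_mul, abs_of_nonneg (a := r ^ 2 / 8) (by positivity)]
    have : |Y t ω - meanPayoff M (X t ω)| ≤ 1 := by
      rw [abs_le]; constructor <;> linarith [h2.1, h2.2, h3.1, h3.2]
    nlinarith [abs_nonneg r]
  · simp; positivity

theorem IsRun.integrable_exp_compensatedNoise (h : IsRun M R ν₁ ρ ℙ V X Y)
    (hM : ∀ x, (M x : Measure ℝ) (Set.Icc 0 1)ᶜ = 0) (hf : Measurable (meanPayoff M))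
    (a : Node) (r : ℝ) (n : ℕ) :
    Integrable (fun ω => Real.exp (compensatedNoise M V X Y a r n ω)) ℙ := by
  refine Integrable.of_bound (C := Real.exp (n * (|r| + r ^ 2 / 8)))
    (measurable_compensatedNoise hf (fun t ht => h.measurable_node t (Finset.mem_Icc.1 ht).1)
      (fun t ht => h.measurable_arm t (Finset.mem_Icc.1 ht).1)
      (fun t ht => h.measurable_reward t (Finset.mem_Icc.1 ht).1) a r).exp.aestronglyMeasurable ?_
  filter_upwards [h.ae_abs_compensatedNoise_le hM a r n] with ω hω
  rw [Real.norm_eq_abs, Real.abs_exp]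
  exact Real.exp_le_exp.2 ((le_abs_self _).trans hω)

/-- The compensated exponential of the noise is a supermartingale started at `1`. -/
theorem IsRun.integral_exp_compensatedNoise_le_one (h : IsRun M R ν₁ ρ ℙ V X Y)
    (hM : ∀ x, (M x : Measure ℝ) (Set.Icc 0 1)ᶜ = 0) (hf : Measurable (meanPayoff M))
    (a : Node) (r : ℝ) (n : ℕ) :
    ∫ ω, Real.exp (compensatedNoise M V X Y a r n ω) ∂ℙ ≤ 1 := by
  classical
  induction n with
  | zero => simp [compensatedNoise]
  | succ n ih =>
    refine le_trans ?_ ih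
    set W : Ω → ℝ := fun ω => Real.exp (compensatedNoise M V X Y a r n ω) with hW
    have hWint : Integrable W ℙ := h.integrable_exp_compensatedNoise hM hf a r n
    set C : Set Ω := {ω | V (n + 1) ω ∈ descendants a} with hC
    have hmem : n + 1 ∈ Finset.Icc 1 (n + 1) := by simp
    have hCm : MeasurableSet[info V X Y (n + 1)] C :=
      (measurable_info_node hmem) (Set.to_countable (descendants a)).measurableSet
    have hCm' : MeasurableSet C := h.info_le _ _ hCm
    have hWm : Measurable[info V X Y (n + 1)] W := by
      refine Measurable.exp (measurable_compensatedNoise hf ?_ ?_ ?_ a r)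
      · exact fun t ht => measurable_info_node (by simp at ht ⊢; omega)
      · exact fun t ht => measurable_info_arm (by simp at ht ⊢; omega)
      · exact fun t ht => measurable_info_reward (by simp at ht ⊢; omega)
    -- The factor gained in round n+1 on `C` splits into `D`, known before the reward is drawn, and
    -- `g (Y (n+1))`. Off `C` the factor is 1.
    set D : Ω → ℝ := fun ω => Real.exp (-(r * meanPayoff M (X (n + 1) ω)) - r ^ 2 / 8) with hD
    have hDm : Measurable[info V X Y (n + 1)] D :=
      (((hf.comp (measurable_info_arm hmem)).const_mul r).neg.sub_const _).exp
    set W' : Ω → ℝ := C.indicator (fun ω => W ω * D ω) with hW'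
    have hW'm : StronglyMeasurable[info V X Y (n + 1)] W' :=
      ((hWm.mul hDm).indicator hCm).stronglyMeasurable
    set g : ℝ → ℝ := fun y => Real.exp (r * max 0 (min 1 y)) with hg
    have hgm : Measurable g := by fun_prop
    have hgb : ∀ y, |g y| ≤ Real.exp |r| := fun y => by
      rw [hg, Real.abs_exp]
      refine Real.exp_le_exp.2 ((le_abs_self _).trans ?_)
      rw [abs_mul]
      refine mul_le_of_le_one_right (abs_nonneg _) ?_
      rw [abs_of_nonneg (le_max_left _ _)]
      exact max_le zero_le_one (min_le_left _ _)
    have hgint : Integrable (fun ω => g (Y (n + 1) ω)) ℙ :=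
      Integrable.of_bound
        (hgm.comp (h.measurable_reward (n + 1) (by omega))).aestronglyMeasurable _
        (ae_of_all _ fun ω => hgb _)
    have hW'b : ∀ᵐ ω ∂ℙ, ‖W' ω‖ ≤ Real.exp (n * (|r| + r ^ 2 / 8)) * Real.exp |r| := by
      filter_upwards [h.ae_abs_compensatedNoise_le hM a r n] with ω hω
      refine (norm_indicator_le_norm_self _ _).trans ?_
      rw [norm_mul, Real.norm_eq_abs, Real.norm_eq_abs, Real.abs_exp, Real.abs_exp]
      have h3 := meanPayoff_mem_Icc hM (X (n + 1) ω)
      refine mul_le_mul (Real.exp_le_exp.2 ((le_abs_self _).trans hω)) (Real.exp_le_exp.2 ?_)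
        (Real.exp_pos _).le (Real.exp_pos _).le
      have : |r * meanPayoff M (X (n + 1) ω)| ≤ |r| := by
        rw [abs_mul, abs_of_nonneg h3.1]
        exact mul_le_of_le_one_right (abs_nonneg _) h3.2
      linarith [neg_abs_le (r * meanPayoff M (X (n + 1) ω)), sq_nonneg r]
    have hprod : Integrable (fun ω => W' ω * g (Y (n + 1) ω)) ℙ :=
      hgint.bdd_mul (hW'm.mono (h.info_le _)).aestronglyMeasurable hW'b
    have hsplit : (fun ω => Real.exp (compensatedNoise M V X Y a r (n + 1) ω)) =ᵐ[ℙ]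
        fun ω => Cᶜ.indicator W ω + W' ω * g (Y (n + 1) ω) := by
      filter_upwards [h.ae_reward_mem hM (show 1 ≤ n + 1 by omega)] with ω hω
      have hs : compensatedNoise M V X Y a r (n + 1) ω = compensatedNoise M V X Y a r n ω +
          if V (n + 1) ω ∈ descendants a then
            r * (Y (n + 1) ω - meanPayoff M (X (n + 1) ω)) - r ^ 2 / 8 else 0 := by
        simp only [compensatedNoise]
        exact Finset.sum_Icc_succ_top (by omega) _
      rw [hs, Real.exp_add]
      by_cases hω' : ω ∈ C
      · rw [if_pos (show V (n + 1) ω ∈ descendants a from hω'),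
          Set.indicator_of_notMem (by simpa using hω'), hW',
          Set.indicator_of_mem hω', zero_add, mul_assoc]
        congr 1
        rw [hD, hg]
        simp only
        rw [min_eq_right hω.2, max_eq_right hω.1, ← Real.exp_add]
        congr 1
        ring
      · rw [if_neg (show V (n + 1) ω ∉ descendants a from hω'),
          Set.indicator_of_mem (by simpa using hω'), hW',
          Set.indicator_of_notMem hω']
        simp [hW]
    have hcond : ∫ ω, W' ω * g (Y (n + 1) ω) ∂ℙ =
        ∫ ω, W' ω * ∫ y, g y ∂(M (X (n + 1) ω) : Measure ℝ) ∂ℙ := by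
      rw [← integral_condExp (h.info_le (n + 1))]
      refine integral_congr_ae ?_
      filter_upwards [condExp_mul_of_stronglyMeasurable_left hW'm hprod hgint,
        h.reward_law (n + 1) (by omega) g hgm ⟨_, hgb⟩] with ω h1 h2
      refine h1.trans ?_
      rw [Pi.mul_apply, h2]
    -- Hoeffding's lemma bounds the conditional mean of `g` by exactly the inverse of `D`.
    have hle : ∀ ω, W' ω * ∫ y, g y ∂(M (X (n + 1) ω) : Measure ℝ) ≤ C.indicator W ω := by
      intro ω
      by_cases hω' : ω ∈ C
      · rw [hW', Set.indicator_of_mem hω', Set.indicator_of_mem hω', mul_assoc]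
        refine mul_le_of_le_one_right (Real.exp_pos _).le ?_
        refine (mul_le_mul_of_nonneg_left (integral_exp_reward_le hM (X (n + 1) ω) r)
          (Real.exp_pos _).le).trans_eq ?_
        rw [← Real.exp_add, Real.exp_eq_one_iff]
        ring
      · rw [hW', Set.indicator_of_notMem hω', Set.indicator_of_notMem hω', zero_mul]
    -- `M` is not assumed to be a measurable kernel, so integrability is inherited from the
    -- conditional expectation.
    have hlawint : Integrable (fun ω => W' ω * ∫ y, g y ∂(M (X (n + 1) ω) : Measure ℝ)) ℙ := by
      refine (integrable_condExp (m := info V X Y (n + 1))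
        (f := fun ω => W' ω * g (Y (n + 1) ω))).congr ?_
      filter_upwards [condExp_mul_of_stronglyMeasurable_left hW'm hprod hgint,
        h.reward_law (n + 1) (by omega) g hgm ⟨_, hgb⟩] with ω h1 h2
      refine h1.trans ?_
      rw [Pi.mul_apply, h2]
    rw [integral_congr_ae hsplit, integral_add (hWint.indicator hCm'.compl) hprod, hcond]
    calc _ ≤ ∫ ω, Cᶜ.indicator W ω ∂ℙ + ∫ ω, C.indicator W ω ∂ℙ := by
            exact add_le_add_right (integral_mono hlawint (hWint.indicator hCm') hle) _
      _ = ∫ ω, W ω ∂ℙ := by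
            rw [← integral_add (hWint.indicator hCm'.compl) (hWint.indicator hCm')]
            refine integral_congr_ae (ae_of_all _ fun ω => ?_)
            exact congrFun (Set.indicator_compl_add_self C W) ω

/-- A deviation of the noise in the direction `σ = ±1`, large compared to the number of visits. -/
def largeDeviation (M : 𝒳 → ProbabilityMeasure ℝ) (V : ℕ → Ω → Node)
    (X : ℕ → Ω → 𝒳) (Y : ℕ → Ω → ℝ) (σ : ℝ) (n : ℕ) (a : Node) : Set Ω :=
  {ω | 0 < count (fun t => V t ω) n a ∧
    Real.sqrt (2 * count (fun t => V t ω) n a * Real.log n) ≤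
      σ * noise M (fun t => V t ω) (fun t => X t ω) (fun t => Y t ω) n a}

/-- The number of visits is random, so each value j ≤ n gets its own Chernoff bound, with |r| = 4√(2
ln n/j). On the event the noise contributes at least 8 ln n to the exponent and the compensator
removes 4 ln n, so Markov's inequality gives n⁻⁴; summing over j costs a factor n. -/
theorem IsRun.measureReal_largeDeviation_le (h : IsRun M R ν₁ ρ ℙ V X Y)
    (hM : ∀ x, (M x : Measure ℝ) (Set.Icc 0 1)ᶜ = 0) (hf : Measurable (meanPayoff M))
    {σ : ℝ} (hσ : σ ^ 2 = 1) (n : ℕ) (a : Node) :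
    ℙ.real (largeDeviation M V X Y σ n a) ≤ 1 / (n : ℝ) ^ 3 := by
  rcases Nat.eq_zero_or_pos n with rfl | hn
  · have : largeDeviation M V X Y σ 0 a = ∅ := by
      ext ω; simp [largeDeviation, count_zero]
    simp [this]
  have hn' : (0 : ℝ) < n := by exact_mod_cast hn
  have hL : 0 ≤ Real.log n := Real.log_natCast_nonneg n
  let E : ℕ → Set Ω := fun j =>
    {ω | (n : ℝ) ^ 4 ≤
      Real.exp (compensatedNoise M V X Y a (σ * (4 * Real.sqrt (2 * Real.log n / j))) n ω)}
  have hsub : largeDeviation M V X Y σ n a ⊆ ⋃ j ∈ Finset.Icc 1 n, E j := by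
    rintro ω ⟨hω1, hω2⟩
    have hcn := count_le (v := fun t => V t ω) n a
    set j := count (fun t => V t ω) n a with hj
    simp only [Set.mem_iUnion]
    refine ⟨j, Finset.mem_Icc.2 ⟨hω1, hcn⟩, ?_⟩
    have hj' : (0 : ℝ) < j := by exact_mod_cast hω1
    change (n : ℝ) ^ 4 ≤ Real.exp _
    have h4 : (n : ℝ) ^ 4 = Real.exp (4 * Real.log n) := by
      rw [mul_comm, Real.exp_mul, Real.exp_log hn']
      norm_cast
    rw [h4, compensatedNoise_eq, Real.exp_le_exp, ← hj, mul_pow, hσ, mul_pow,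
      Real.sq_sqrt (by positivity)]
    set S := noise M (fun t => V t ω) (fun t => X t ω) (fun t => Y t ω) n a
    have h5 : Real.sqrt (2 * Real.log n / j) * Real.sqrt (2 * j * Real.log n) =
        2 * Real.log n := by
      rw [← Real.sqrt_mul (by positivity), Real.sqrt_eq_iff_mul_self_eq (by positivity)
        (by positivity)]
      field_simp
    have h6 := mul_le_mul_of_nonneg_left hω2 (Real.sqrt_nonneg (2 * Real.log n / j))
    rw [h5] at h6
    have h7 : 1 * (4 ^ 2 * (2 * Real.log n / j)) / 8 * (j : ℝ) = 4 * Real.log n := by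
      field_simp; ring
    rw [h7]
    linarith
  have hE : ∀ j, ℙ.real (E j) ≤ 1 / (n : ℝ) ^ 4 := by
    intro j
    rw [le_div_iff₀ (by positivity), mul_comm]
    exact (mul_meas_ge_le_integral_of_nonneg (ae_of_all _ fun ω => (Real.exp_pos _).le)
      (h.integrable_exp_compensatedNoise hM hf a _ n) _).trans
        (h.integral_exp_compensatedNoise_le_one hM hf a _ n)
  calc ℙ.real (largeDeviation M V X Y σ n a) ≤ ℙ.real (⋃ j ∈ Finset.Icc 1 n, E j) :=
        measureReal_mono hsub (measure_ne_top _ _)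
    _ ≤ ∑ j ∈ Finset.Icc 1 n, ℙ.real (E j) := measureReal_biUnion_finset_le _ _
    _ ≤ ∑ j ∈ Finset.Icc 1 n, 1 / (n : ℝ) ^ 4 := Finset.sum_le_sum fun j _ => hE j
    _ = 1 / (n : ℝ) ^ 3 := by
        simp only [Finset.sum_const, Nat.card_Icc, nsmul_eq_mul, Nat.add_sub_cancel]
        field_simp

end Concentration

/-! ### Consequences for `U`-values when the noise does not deviate -/

section Deterministic

variable {𝒳 : Type*} {M : 𝒳 → ProbabilityMeasure ℝ} {R : ℕ → ℕ → Set 𝒳} {ℓ : 𝒳 → 𝒳 → ℝ}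
  {ν₁ ρ ν₂ : ℝ} {v : ℕ → Node} {x : ℕ → 𝒳} {y : ℕ → ℝ}

theorem empMean_eq (n : ℕ) (a : Node) :
    empMean v y n a =
      (noise M v x y n a + ∑ t ∈ visits v n a, meanPayoff M (x t)) / count v n a := by
  simp [empMean, noise, Finset.sum_sub_distrib]

theorem sqrt_bonus_eq {c L : ℝ} (hc : 0 < c) : Real.sqrt (2 * L / c) = Real.sqrt (2 * c * L) / c := by
  rw [eq_div_iff hc.ne', show 2 * c * L = 2 * L / c * (c * c) by field_simp,
    Real.sqrt_mul' _ (by positivity), Real.sqrt_mul_self hc.le]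

variable [MeasurableSpace 𝒳]

/-- In the absence of a large deviation, the `U`-value of an optimal node exceeds `f*`. -/
theorem fstar_lt_Uvalue (hR : IsTreeOfCoverings R) (hν₁ : 0 < ν₁) (hρ : 0 < ρ)
    (hA1 : ShrinksGeometrically R ℓ ν₁ ρ ν₂) (hA2 : WeaklyLipschitz (meanPayoff M) ℓ)
    (hx : ∀ t, 1 ≤ t → x t ∈ R (v t).1 (v t).2)
    {a : Node} (ha : a ∈ descendants root) (hopt : IsNearOptimalNode (meanPayoff M) R a 0) {n : ℕ}
    (hdev : ¬ (0 < count v n a ∧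
      Real.sqrt (2 * count v n a * Real.log n) ≤ -1 * noise M v x y n a)) :
    (fstar (meanPayoff M) : EReal) < Uvalue ν₁ ρ v y n a := by
  unfold Uvalue
  split_ifs with hc
  · rw [EReal.coe_lt_coe_iff]
    have hdev' : -1 * noise M v x y n a < Real.sqrt (2 * count v n a * Real.log n) :=
      not_le.1 fun h => hdev ⟨hc, h⟩
    have hc' : (0 : ℝ) < count v n a := by exact_mod_cast hc
    -- The bias of the average is at most ν₁ρ^h, which the last term of `U` makes up for.
    have hsum : count v n a * (fstar (meanPayoff M) - ν₁ * ρ ^ a.1) ≤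
        ∑ t ∈ visits v n a, meanPayoff M (x t) := by
      rw [← nsmul_eq_mul, count]
      refine Finset.card_nsmul_le_sum _ _ _ fun t ht => ?_
      rw [mem_visits] at ht
      have h1 := hopt.fstar_sub_le hA1 hA2 hν₁ hρ ha
        (hR.region_subset ha ht.2 (hx t ht.1.1))
      rw [max_eq_right (by positivity)] at h1
      linarith
    rw [empMean_eq (M := M) (x := x), sqrt_bonus_eq hc', ← sub_lt_iff_lt_add, ← add_div,
      lt_div_iff₀ hc']
    linarith
  · exact EReal.coe_lt_top _

/-- If the `U`-value of a well explored suboptimal node exceeds `f*`, then there was a large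
deviation. -/
theorem sqrt_le_noise_of_fstar_lt_Uvalue (hR : IsTreeOfCoverings R) (hν₁ : 0 < ν₁) (hρ : 0 < ρ)
    (hx : ∀ t, 1 ≤ t → x t ∈ R (v t).1 (v t).2)
    {a : Node} (ha : a ∈ descendants root)
    (hsub : ¬ IsNearOptimalNode (meanPayoff M) R a (2 * (ν₁ * ρ ^ a.1))) {n N : ℕ} (hn : n ≤ N)
    (hc : 8 * Real.log N / (ν₁ * ρ ^ a.1) ^ 2 < count v n a)
    (hU : (fstar (meanPayoff M) : EReal) < Uvalue ν₁ ρ v y n a) :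
    0 < count v n a ∧ Real.sqrt (2 * count v n a * Real.log n) ≤ 1 * noise M v x y n a := by
  set w := ν₁ * ρ ^ a.1 with hw
  have hwpos : 0 < w := by positivity
  have hc' : (0 : ℝ) < count v n a :=
    lt_of_le_of_lt (by have := Real.log_natCast_nonneg N; positivity) hc
  have hc0 : 0 < count v n a := by exact_mod_cast hc'
  refine ⟨hc0, ?_⟩
  have hn0 : 0 < n := by have := count_le (v := v) n a; omega
  rw [Uvalue, if_pos hc0, EReal.coe_lt_coe_iff, empMean_eq (M := M) (x := x), sqrt_bonus_eq hc',
    ← sub_lt_iff_lt_add, ← add_div, lt_div_iff₀ hc', ← hw] at hU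
  have hsum : ∑ t ∈ visits v n a, meanPayoff M (x t) ≤
      count v n a * (fstar (meanPayoff M) - 2 * w) := by
    rw [← nsmul_eq_mul, count]
    refine Finset.sum_le_card_nsmul _ _ _ fun t ht => ?_
    rw [mem_visits] at ht
    exact le_of_not_isNearOptimalNode hsub (hR.region_subset ha ht.2 (hx t ht.1.1))
  have hlog : Real.log n ≤ Real.log N :=
    Real.log_le_log (by exact_mod_cast hn0) (by exact_mod_cast hn)
  -- The threshold 8 ln N/w² is where the confidence width drops to w/2. Width, noise below the
  -- width and the term w of `U` then add up to at most the gap 2w.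
  have hsqrt : 2 * Real.sqrt (2 * count v n a * Real.log n) ≤ count v n a * w := by
    rw [div_lt_iff₀ (by positivity)] at hc
    have : Real.sqrt (2 * count v n a * Real.log n) ≤ count v n a * w / 2 := by
      refine Real.sqrt_le_iff.2 ⟨by positivity, ?_⟩
      have : 8 * Real.log n * count v n a ≤ count v n a * w ^ 2 * count v n a :=
        mul_le_mul_of_nonneg_right (by linarith) hc'.le
      linarith
    linarith
  linarith

end Deterministic

/-! ### Expected number of visits to a suboptimal node -/

section Count

variable {𝒳 : Type*} {Ω : Type*} [MeasurableSpace 𝒳] [MeasurableSpace Ω]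
  {M : 𝒳 → ProbabilityMeasure ℝ} {R : ℕ → ℕ → Set 𝒳} {ℓ : 𝒳 → 𝒳 → ℝ} {ν₁ ρ ν₂ : ℝ}
  {ℙ : Measure Ω}
  {V : ℕ → Ω → Node} {X : ℕ → Ω → 𝒳} {Y : ℕ → Ω → ℝ}

theorem IsRun.measurable_count (h : IsRun M R ν₁ ρ ℙ V X Y) (n : ℕ) (a : Node) :
    Measurable fun ω => (count (fun t => V t ω) n a : ℝ) := by
  classical
  have : (fun ω => (count (fun t => V t ω) n a : ℝ)) = fun ω =>
      ∑ t ∈ Finset.Icc 1 n, if V t ω ∈ descendants a then (1 : ℝ) else 0 := by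
    ext ω
    rw [count, visits, Finset.card_filter]
    push_cast
    congr!
  rw [this]
  refine Finset.measurable_fun_sum _ fun t ht => ?_
  exact Measurable.ite (h.measurable_node t (Finset.mem_Icc.1 ht).1
    (Set.to_countable (descendants a)).measurableSet) measurable_const measurable_const

variable [IsProbabilityMeasure ℙ]

theorem IsRun.integrable_count (h : IsRun M R ν₁ ρ ℙ V X Y) (n : ℕ) (a : Node) :
    Integrable (fun ω => (count (fun t => V t ω) n a : ℝ)) ℙ := by
  refine Integrable.of_bound (h.measurable_count n a).aestronglyMeasurable n (ae_of_all _ fun ω => ?_)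
  rw [Real.norm_natCast]
  exact_mod_cast count_le n a

/-- The expected number of visits of a suboptimal node is logarithmic. -/
theorem IsRun.integral_count_le [Nonempty 𝒳] (h : IsRun M R ν₁ ρ ℙ V X Y)
    (hM : ∀ x, (M x : Measure ℝ) (Set.Icc 0 1)ᶜ = 0) (hf : Measurable (meanPayoff M))
    (hν₁ : 0 < ν₁) (hρ : 0 < ρ) (hR : IsTreeOfCoverings R)
    (hA1 : ShrinksGeometrically R ℓ ν₁ ρ ν₂) (hA2 : WeaklyLipschitz (meanPayoff M) ℓ)
    {a : Node} (ha : a ∈ descendants root)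
    (hsub : ¬ IsNearOptimalNode (meanPayoff M) R a (2 * (ν₁ * ρ ^ a.1))) (n : ℕ) :
    ∫ ω, (count (fun t => V t ω) n a : ℝ) ∂ℙ ≤
      8 * Real.log n / (ν₁ * ρ ^ a.1) ^ 2 + 1 + ∑' t : ℕ, 3 * (1 / (t : ℝ) ^ 2) := by
  classical
  obtain ⟨o, ho0, ho, hopt⟩ := exists_optimal_path hR (meanPayoff M)
  -- In round t+1 only an optimal-path node of depth at most t, or `a` itself, can be responsible
  -- for a visit beyond the threshold.
  let E : ℕ → Set Ω := fun t => (⋃ s ∈ Finset.range (t + 1),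
    largeDeviation M V X Y (-1) t (o s)) ∪ largeDeviation M V X Y 1 t a
  have hE : ∀ t, ℙ.real (E t) ≤ 3 * (1 / (t : ℝ) ^ 2) := by
    intro t
    calc ℙ.real (E t) ≤ ∑ s ∈ Finset.range (t + 1), ℙ.real (largeDeviation M V X Y (-1) t (o s)) +
          ℙ.real (largeDeviation M V X Y 1 t a) :=
        (measureReal_union_le _ _).trans (by gcongr; exact measureReal_biUnion_finset_le _ _)
      _ ≤ ∑ s ∈ Finset.range (t + 1), 1 / (t : ℝ) ^ 3 + 1 / (t : ℝ) ^ 3 :=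
        add_le_add (Finset.sum_le_sum fun s _ =>
          h.measureReal_largeDeviation_le hM hf (by norm_num) t _)
          (h.measureReal_largeDeviation_le hM hf (by norm_num) t a)
      _ = (t + 2) * (1 / (t : ℝ) ^ 3) := by
        simp only [Finset.sum_const, Finset.card_range, nsmul_eq_mul]; push_cast; ring
      _ ≤ 3 * (1 / (t : ℝ) ^ 2) := by
        rcases Nat.eq_zero_or_pos t with rfl | ht
        · simp
        · have ht' : (1 : ℝ) ≤ t := by exact_mod_cast ht
          rw [mul_one_div, mul_one_div, div_le_div_iff₀ (by positivity) (by positivity)]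
          nlinarith [pow_pos (lt_of_lt_of_le one_pos ht') 2]
  -- Measurable hulls have the same measure and spare a proof that the events are measurable.
  let B : ℕ → Set Ω := fun t => toMeasurable ℙ (E t)
  have hBm : ∀ t, MeasurableSet (B t) := fun t => measurableSet_toMeasurable _ _
  have hBr : ∀ t, ℙ.real (B t) = ℙ.real (E t) := fun t => by
    simp only [B, Measure.real, measure_toMeasurable]
  set u := 8 * Real.log n / (ν₁ * ρ ^ a.1) ^ 2 with hu
  have hu0 : 0 ≤ u := by have := Real.log_natCast_nonneg n; positivity
  have hsel : ∀ᵐ ω ∂ℙ, ∀ t, Selects ν₁ ρ (fun t => V t ω) (fun t => Y t ω) t (V (t + 1) ω) :=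
    ae_all_iff.2 h.node_selected
  have harm : ∀ᵐ ω ∂ℙ, ∀ t, 1 ≤ t → X t ω ∈ R (V t ω).1 (V t ω).2 :=
    ae_all_iff.2 fun t => Filter.eventually_imp_distrib_left.2 (h.arm_mem t)
  have hpt : ∀ᵐ ω ∂ℙ, (count (fun t => V t ω) n a : ℝ) ≤
      u + 1 + ∑ t ∈ Finset.range n, (B t).indicator 1 ω := by
    filter_upwards [hsel, harm] with ω hsel harm
    refine (count_le_add_sum_indicator a hu0 (fun t => ω ∈ B t) n ?_).trans_eq
      (by simp [Set.indicator_apply])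
    intro t ht hva hut
    refine subset_toMeasurable _ _ ?_
    by_contra hcon
    simp only [E, Set.mem_union, Set.mem_iUnion, not_or, not_exists] at hcon
    refine hcon.2 (sqrt_le_noise_of_fstar_lt_Uvalue hR hν₁ hρ harm ha hsub ht.le hut ?_)
    refine lt_Uvalue_of_selects hsel (EReal.coe_lt_top _) ho0 ho (fun s => ?_) ha hva
    refine fstar_lt_Uvalue hR hν₁ hρ hA1 hA2 harm (hopt s).1 (hopt s).2.2 ?_
    by_cases hs : s < t + 1
    · exact hcon.1 s (Finset.mem_range.2 hs)
    -- Nodes deeper than t have not been visited by the end of round t, so they cannot deviate.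
    · rintro ⟨h1, -⟩
      rw [count_eq_zero_of_depth hsel (by rw [(hopt s).2.1]; omega)] at h1
      exact lt_irrefl 0 h1
  have hind : ∀ t, Integrable ((B t).indicator (1 : Ω → ℝ)) ℙ := fun t =>
    (integrable_const (1 : ℝ)).indicator (hBm t)
  calc ∫ ω, (count (fun t => V t ω) n a : ℝ) ∂ℙ
      ≤ ∫ ω, (u + 1 + ∑ t ∈ Finset.range n, (B t).indicator 1 ω) ∂ℙ :=
        integral_mono_ae (h.integrable_count n a)
          ((integrable_const _).add (integrable_finsetSum _ fun t _ => hind t)) hpt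
    _ = u + 1 + ∑ t ∈ Finset.range n, ℙ.real (E t) := by
        rw [integral_add (integrable_const _) (integrable_finsetSum _ fun t _ => hind t),
          integral_finsetSum _ fun t _ => hind t]
        simp [integral_indicator_one, hBm, hBr]
    _ ≤ u + 1 + ∑' t : ℕ, 3 * (1 / (t : ℝ) ^ 2) := by
        gcongr
        exact (Finset.sum_le_sum fun t _ => hE t).trans
          (((Real.summable_one_div_nat_pow.2 one_lt_two).mul_left 3).sum_le_tsum _
            fun t _ => by positivity)

end Count

/-! ### Counting near-optimal nodes and splitting the regret -/

section Decomposition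

variable {𝒳 : Type*} {f : 𝒳 → ℝ} {R : ℕ → ℕ → Set 𝒳} {ℓ : 𝒳 → 𝒳 → ℝ} {ν₁ ρ ν₂ : ℝ}

open Classical in
/-- The nodes at depth `h` that are `2 ν₁ ρ ^ h`-optimal. -/
noncomputable def nearOptimalNodes (f : 𝒳 → ℝ) (R : ℕ → ℕ → Set 𝒳) (ν₁ ρ : ℝ) (h : ℕ) :
    Finset Node :=
  ((Finset.Icc 1 (2 ^ h)).image (Prod.mk h)).filter fun a =>
    a ∈ descendants root ∧ IsNearOptimalNode f R a (2 * (ν₁ * ρ ^ h))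

open Classical in
/-- The children of the nodes of `nearOptimalNodes` at depth `h` that are not near-optimal. -/
noncomputable def fringe (f : 𝒳 → ℝ) (R : ℕ → ℕ → Set 𝒳) (ν₁ ρ : ℝ) (h : ℕ) : Finset Node :=
  ((nearOptimalNodes f R ν₁ ρ h).image left ∪ (nearOptimalNodes f R ν₁ ρ h).image right).filter
    fun a => ¬ IsNearOptimalNode f R a (2 * (ν₁ * ρ ^ (h + 1)))

theorem mem_nearOptimalNodes {h : ℕ} {a : Node} : a ∈ nearOptimalNodes f R ν₁ ρ h ↔
    a.1 = h ∧ a ∈ descendants root ∧ IsNearOptimalNode f R a (2 * (ν₁ * ρ ^ h)) := by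
  simp only [nearOptimalNodes, Finset.mem_filter, Finset.mem_image, Finset.mem_Icc]
  constructor
  · rintro ⟨⟨i, hi, rfl⟩, h⟩
    exact ⟨rfl, h⟩
  · rintro ⟨rfl, h⟩
    exact ⟨⟨a.2, index_bounds h.1, rfl⟩, h⟩

theorem mem_fringe {h : ℕ} {b : Node} : b ∈ fringe f R ν₁ ρ h ↔
    (∃ a ∈ nearOptimalNodes f R ν₁ ρ h, IsChild a b) ∧
      ¬ IsNearOptimalNode f R b (2 * (ν₁ * ρ ^ (h + 1))) := by
  simp only [fringe, Finset.mem_filter, Finset.mem_union, Finset.mem_image, IsChild, and_congr_left_iff]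
  intro _
  constructor
  · rintro (⟨a, ha, rfl⟩ | ⟨a, ha, rfl⟩)
    · exact ⟨a, ha, .inl rfl⟩
    · exact ⟨a, ha, .inr rfl⟩
  · rintro ⟨a, ha, rfl | rfl⟩
    · exact .inl ⟨a, ha, rfl⟩
    · exact .inr ⟨a, ha, rfl⟩

theorem card_nearOptimalNodes_le_two_pow (h : ℕ) :
    (nearOptimalNodes f R ν₁ ρ h).card ≤ 2 ^ h := by
  classical
  refine (Finset.card_filter_le _ _).trans (Finset.card_image_le.trans (by simp))

theorem card_fringe_le (h : ℕ) :
    (fringe f R ν₁ ρ h).card ≤ 2 * (nearOptimalNodes f R ν₁ ρ h).card := by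
  classical
  refine (Finset.card_filter_le _ _).trans ((Finset.card_union_le _ _).trans ?_)
  have h1 := Finset.card_image_le (s := nearOptimalNodes f R ν₁ ρ h) (f := left)
  have h2 := Finset.card_image_le (s := nearOptimalNodes f R ν₁ ρ h) (f := right)
  omega

/-- With slack 2ν₁ρ^h the maximum in the weak Lipschitz bound is the slack itself, which then counts
twice. This is the source of the 4 in c = 4ν₁/ν₂. -/
theorem fstar_sub_le_of_mem_nearOptimalNodes (hA1 : ShrinksGeometrically R ℓ ν₁ ρ ν₂)
    (hA2 : WeaklyLipschitz f ℓ) (hν₁ : 0 < ν₁) (hρ : 0 < ρ) {h : ℕ} {a : Node}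
    (ha : a ∈ nearOptimalNodes f R ν₁ ρ h) {y : 𝒳} (hy : y ∈ R a.1 a.2) :
    fstar f - f y ≤ 4 * ν₁ * ρ ^ h := by
  obtain ⟨rfl, ha, hopt⟩ := mem_nearOptimalNodes.1 ha
  have h1 := hopt.fstar_sub_le hA1 hA2 hν₁ hρ ha hy
  have h2 : 0 < ν₁ * ρ ^ a.1 := by positivity
  rw [max_eq_left (by linarith)] at h1
  linarith

/-- Disjoint balls show that there are few near-optimal nodes. -/
theorem card_nearOptimalNodes_le_packingNumber (hA1 : ShrinksGeometrically R ℓ ν₁ ρ ν₂)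
    (hA2 : WeaklyLipschitz f ℓ) (hν₁ : 0 < ν₁) (hρ : 0 < ρ) (h : ℕ) :
    ((nearOptimalNodes f R ν₁ ρ h).card : ℕ∞) ≤
      packingNumber (nearOptimal f (4 * ν₁ * ρ ^ h)) ℓ (ν₂ * ρ ^ h) := by
  obtain ⟨x₀, hx₀, hdisj⟩ := hA1.2
  let e := (nearOptimalNodes f R ν₁ ρ h).equivFin.symm
  have he : ∀ i, (e i).1.1 = h ∧ (e i).1 ∈ descendants root := fun i =>
    ⟨(mem_nearOptimalNodes.1 (e i).2).1, (mem_nearOptimalNodes.1 (e i).2).2.1⟩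
  refine le_iSup₂_of_le (nearOptimalNodes f R ν₁ ρ h).card ⟨fun i => x₀ h (e i).1.2, ?_, ?_⟩ le_rfl
  · intro i z hz
    have hb := index_bounds (he i).2
    rw [(he i).1] at hb
    have hz' := (hx₀ h (e i).1.2 hb.1 hb.2).2 hz
    have h1 := fstar_sub_le_of_mem_nearOptimalNodes hA1 hA2 hν₁ hρ (e i).2 (y := z)
      (by rw [(he i).1]; exact hz')
    change fstar f - _ ≤ f z
    linarith
  · intro i j hij
    have hi := index_bounds (he i).2
    have hj := index_bounds (he j).2
    rw [(he i).1] at hi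
    rw [(he j).1] at hj
    rcases lt_trichotomy (e i).1.2 (e j).1.2 with hlt | heq | hlt
    · exact hdisj h _ _ hi.1 hlt hj.2
    · exfalso
      refine hij (e.injective (Subtype.ext (Prod.ext ?_ heq)))
      rw [(he i).1, (he j).1]
    · exact (hdisj h _ _ hj.1 hlt hi.2).symm

theorem nearOptimalityDimension_nonneg (c : ℝ) (f : 𝒳 → ℝ) (ℓ : 𝒳 → 𝒳 → ℝ) :
    0 ≤ nearOptimalityDimension c f ℓ := le_max_left _ _

/-- Beyond the near-optimality dimension, packing numbers are eventually bounded by a power. -/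
theorem eventually_packingNumber_le {c d' : ℝ} (hd' : nearOptimalityDimension c f ℓ < (d' : EReal)) :
    ∀ᶠ ε in 𝓝[>] (0 : ℝ), ((packingNumber (nearOptimal f (c * ε)) ℓ ε : ℕ∞) : ℝ≥0∞) ≤
      ENNReal.ofReal (ε ^ (-d')) := by
  have h1 := eventually_lt_of_limsup_lt ((le_max_right _ _).trans_lt hd')
  filter_upwards [h1, self_mem_nhdsWithin, nhdsWithin_le_nhds (Iio_mem_nhds one_pos)]
    with ε hε hpos hlt
  have hpos : 0 < ε := hpos
  have hlog : 0 < Real.log ε⁻¹ := Real.log_pos ((one_lt_inv₀ hpos).2 hlt)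
  have h2 := (EReal.div_lt_iff (EReal.coe_pos.2 hlog) (EReal.coe_ne_top _)).1 hε
  rw [← ENNReal.log_le_log_iff, ENNReal.log_ofReal_of_pos (Real.rpow_pos_of_pos hpos _),
    Real.log_rpow hpos]
  refine h2.le.trans_eq ?_
  rw [Real.log_inv, ← EReal.coe_mul]
  congr 1
  ring

/-- At scale ε = ν₂ρ^h one has cε = 4ν₁ρ^h, so the packing bound applies at all large depths. The
finitely many others are absorbed by 2^h₀, since (ρ^h)^(-d') ≥ 1. -/
theorem exists_card_nearOptimalNodes_le (hA1 : ShrinksGeometrically R ℓ ν₁ ρ ν₂)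
    (hA2 : WeaklyLipschitz f ℓ) (hν₁ : 0 < ν₁) (hρ : 0 < ρ) (hρ₁ : ρ < 1) (hν₂ : 0 < ν₂) {d' : ℝ}
    (hd' : nearOptimalityDimension (4 * ν₁ / ν₂) f ℓ < (d' : EReal)) :
    ∃ K : ℝ, 0 ≤ K ∧ ∀ h, ((nearOptimalNodes f R ν₁ ρ h).card : ℝ) ≤ K * (ρ ^ h) ^ (-d') := by
  have hd0 : 0 < d' :=
    EReal.coe_pos.1 ((nearOptimalityDimension_nonneg (4 * ν₁ / ν₂) f ℓ).trans_lt hd')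
  have htend : Tendsto (fun h : ℕ => ν₂ * ρ ^ h) atTop (𝓝[>] 0) := by
    refine tendsto_nhdsWithin_iff.2 ⟨?_, Eventually.of_forall fun h => ?_⟩
    · simpa using (tendsto_pow_atTop_nhds_zero_of_lt_one hρ.le hρ₁).const_mul ν₂
    · exact mul_pos hν₂ (pow_pos hρ h)
  obtain ⟨h₀, hh₀⟩ := eventually_atTop.1 (htend.eventually (eventually_packingNumber_le hd'))
  refine ⟨ν₂ ^ (-d') + 2 ^ h₀, by positivity, fun h => ?_⟩
  have hρh : 0 < ρ ^ h := pow_pos hρ h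
  have hpw : 0 < (ρ ^ h) ^ (-d') := Real.rpow_pos_of_pos hρh _
  rw [add_mul]
  by_cases hh : h₀ ≤ h
  · have h1 := card_nearOptimalNodes_le_packingNumber hA1 hA2 hν₁ hρ h
    have h2 := hh₀ h hh
    rw [show 4 * ν₁ / ν₂ * (ν₂ * ρ ^ h) = 4 * ν₁ * ρ ^ h by field_simp] at h2
    have h3 : ((nearOptimalNodes f R ν₁ ρ h).card : ℝ≥0∞) ≤
        ENNReal.ofReal ((ν₂ * ρ ^ h) ^ (-d')) := by
      refine le_trans ?_ h2
      exact_mod_cast ENat.toENNReal_le.2 h1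
    rw [← ENNReal.ofReal_natCast, ENNReal.ofReal_le_ofReal_iff (by positivity),
      Real.mul_rpow hν₂.le hρh.le] at h3
    exact h3.trans (le_add_of_nonneg_right (by positivity))
  · have h1 : ((nearOptimalNodes f R ν₁ ρ h).card : ℝ) ≤ 2 ^ h := by
      exact_mod_cast card_nearOptimalNodes_le_two_pow h
    have h2 : (2 : ℝ) ^ h ≤ 2 ^ h₀ := pow_le_pow_right₀ one_le_two (by omega)
    have h3 : 1 ≤ (ρ ^ h) ^ (-d') :=
      Real.one_le_rpow_of_pos_of_le_one_of_nonpos hρh (pow_le_one₀ hρ.le hρ₁.le) (by linarith)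
    have h4 : (2 : ℝ) ^ h₀ * 1 ≤ 2 ^ h₀ * (ρ ^ h) ^ (-d') := by gcongr
    have : 0 ≤ ν₂ ^ (-d') * (ρ ^ h) ^ (-d') := by positivity
    linarith

variable [MeasurableSpace 𝒳]

/-- Every node lies below a near-optimal node at depth `H`, or is a near-optimal node at a smaller
depth, or lies below a suboptimal child of such a node. -/
theorem node_trichotomy [Nonempty 𝒳] (hR : IsTreeOfCoverings R) (hν₁ : 0 < ν₁) (hρ : 0 < ρ) (H : ℕ)
    {b : Node} (hb : b ∈ descendants root) :
    (∃ a ∈ nearOptimalNodes f R ν₁ ρ H, b ∈ descendants a) ∨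
    (∃ h < H, b ∈ nearOptimalNodes f R ν₁ ρ h) ∨
    ∃ h < H, ∃ a ∈ fringe f R ν₁ ρ h, b ∈ descendants a := by
  rw [mem_descendants] at hb
  induction hb with
  | refl =>
    have h0 : root ∈ nearOptimalNodes f R ν₁ ρ 0 :=
      mem_nearOptimalNodes.2 ⟨rfl, self_mem_descendants _,
        (isNearOptimalNode_root hR).mono (by positivity)⟩
    rcases Nat.eq_zero_or_pos H with rfl | hH
    · exact .inl ⟨root, h0, self_mem_descendants _⟩
    · exact .inr (.inl ⟨0, hH, h0⟩)
  | @tail b b' hb hbb' ih =>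
    rcases ih with ⟨a, ha, hab⟩ | ⟨h, hh, hbI⟩ | ⟨h, hh, a, ha, hab⟩
    · exact .inl ⟨a, ha, IsChild.mem_descendants hbb' hab⟩
    · by_cases hopt : IsNearOptimalNode f R b' (2 * (ν₁ * ρ ^ (h + 1)))
      · have hmem : b' ∈ nearOptimalNodes f R ν₁ ρ (h + 1) := mem_nearOptimalNodes.2
          ⟨by rw [IsChild.depth hbb', (mem_nearOptimalNodes.1 hbI).1], hb.tail hbb', hopt⟩
        rcases Nat.lt_or_ge (h + 1) H with hlt | hge
        · exact .inr (.inl ⟨h + 1, hlt, hmem⟩)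
        · obtain rfl : H = h + 1 := by omega
          exact .inl ⟨b', hmem, self_mem_descendants _⟩
      · exact .inr (.inr ⟨h, hh, b', mem_fringe.2 ⟨⟨b, hbI, hbb'⟩, hopt⟩, self_mem_descendants _⟩)
    · exact .inr (.inr ⟨h, hh, a, ha, IsChild.mem_descendants hbb' hab⟩)

open Classical in
-- One round is charged to whichever case of the trichotomy holds. All the other terms are
-- nonnegative, so overlaps between the cases do no harm.
theorem fstar_sub_le_sum [Nonempty 𝒳] (hR : IsTreeOfCoverings R)
    (hA1 : ShrinksGeometrically R ℓ ν₁ ρ ν₂) (hA2 : WeaklyLipschitz f ℓ) (hν₁ : 0 < ν₁) (hρ : 0 < ρ)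
    (H : ℕ) {b : Node} (hb : b ∈ descendants root) {y : 𝒳} (hy : y ∈ R b.1 b.2) :
    fstar f - f y ≤ 4 * ν₁ * ρ ^ H + ∑ h ∈ Finset.range H, 4 * ν₁ * ρ ^ h *
      (∑ a ∈ nearOptimalNodes f R ν₁ ρ h, (if b = a then 1 else 0) +
        ∑ a ∈ fringe f R ν₁ ρ h, if b ∈ descendants a then 1 else 0) := by
  have hI : ∀ h, (0 : ℝ) ≤ ∑ a ∈ nearOptimalNodes f R ν₁ ρ h, if b = a then 1 else 0 := fun h =>
    Finset.sum_nonneg fun a _ => by split_ifs <;> norm_num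
  have hJ : ∀ h, (0 : ℝ) ≤ ∑ a ∈ fringe f R ν₁ ρ h, if b ∈ descendants a then 1 else 0 := fun h =>
    Finset.sum_nonneg fun a _ => by split_ifs <;> norm_num
  have hterm : ∀ h, 0 ≤ 4 * ν₁ * ρ ^ h * (∑ a ∈ nearOptimalNodes f R ν₁ ρ h, (if b = a then 1 else 0) +
        ∑ a ∈ fringe f R ν₁ ρ h, if b ∈ descendants a then (1 : ℝ) else 0) := fun h =>
    mul_nonneg (by positivity) (add_nonneg (hI h) (hJ h))
  have hH : 0 ≤ 4 * ν₁ * ρ ^ H := by positivity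
  have key : ∀ h < H, fstar f - f y ≤ 4 * ν₁ * ρ ^ h →
      1 ≤ (∑ a ∈ nearOptimalNodes f R ν₁ ρ h, (if b = a then 1 else 0) +
        ∑ a ∈ fringe f R ν₁ ρ h, if b ∈ descendants a then (1 : ℝ) else 0) →
      fstar f - f y ≤ 4 * ν₁ * ρ ^ H + ∑ h ∈ Finset.range H, 4 * ν₁ * ρ ^ h *
      (∑ a ∈ nearOptimalNodes f R ν₁ ρ h, (if b = a then 1 else 0) +
        ∑ a ∈ fringe f R ν₁ ρ h, if b ∈ descendants a then 1 else 0) := by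
    intro h hh hle h1
    have h2 := Finset.single_le_sum (fun h _ => hterm h) (Finset.mem_range.2 hh)
    have h3 : 4 * ν₁ * ρ ^ h * 1 ≤ _ := mul_le_mul_of_nonneg_left h1 (by positivity)
    linarith
  rcases node_trichotomy (f := f) hR hν₁ hρ H hb with ⟨a, ha, hab⟩ | ⟨h, hh, hbI⟩ | ⟨h, hh, a, ha, hab⟩
  · have h1 := fstar_sub_le_of_mem_nearOptimalNodes hA1 hA2 hν₁ hρ ha
      (hR.region_subset (mem_nearOptimalNodes.1 ha).2.1 hab hy)
    have := Finset.sum_nonneg fun h (_ : h ∈ Finset.range H) => hterm h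
    linarith
  · refine key h hh (fstar_sub_le_of_mem_nearOptimalNodes hA1 hA2 hν₁ hρ hbI hy) ?_
    have := Finset.single_le_sum (f := fun a => if b = a then (1 : ℝ) else 0)
      (fun a _ => by split_ifs <;> norm_num) hbI
    simp only [if_true] at this
    linarith [hJ h]
  · obtain ⟨⟨p, hp, hpa⟩, -⟩ := mem_fringe.1 ha
    refine key h hh (fstar_sub_le_of_mem_nearOptimalNodes hA1 hA2 hν₁ hρ hp ?_) ?_
    · have hproot := (mem_nearOptimalNodes.1 hp).2.1
      exact hR.region_subset hproot
        (Relation.ReflTransGen.trans (hpa.mem_descendants (self_mem_descendants p)) hab) hy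
    · have := Finset.single_le_sum (f := fun a => if b ∈ descendants a then (1 : ℝ) else 0)
        (fun a _ => by split_ifs <;> norm_num) ha
      simp only [hab, if_true] at this
      linarith [hI h]

/-- The regret is bounded by the number of near-optimal nodes and of visits below the fringe. -/
theorem regret_le_sum_count [Nonempty 𝒳] (hR : IsTreeOfCoverings R)
    (hA1 : ShrinksGeometrically R ℓ ν₁ ρ ν₂) (hA2 : WeaklyLipschitz f ℓ) (hν₁ : 0 < ν₁) (hρ : 0 < ρ)
    {v : ℕ → Node} {x : ℕ → 𝒳} {y : ℕ → ℝ} (hsel : ∀ n, Selects ν₁ ρ v y n (v (n + 1)))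
    (hx : ∀ t, 1 ≤ t → x t ∈ R (v t).1 (v t).2) (H n : ℕ) :
    n * fstar f - ∑ t ∈ Finset.Icc 1 n, f (x t) ≤
      4 * ν₁ * ρ ^ H * n + ∑ h ∈ Finset.range H, 4 * ν₁ * ρ ^ h *
        ((nearOptimalNodes f R ν₁ ρ h).card + ∑ a ∈ fringe f R ν₁ ρ h, (count v n a : ℝ)) := by
  classical
  have hvroot : ∀ t, 1 ≤ t → v t ∈ descendants root := fun t ht => by
    obtain ⟨s, rfl⟩ : ∃ s, t = s + 1 := ⟨t - 1, by omega⟩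
    exact (hsel s).mem_descendants
  have hone : ∀ a, ∑ t ∈ Finset.Icc 1 n, (if v t = a then (1 : ℝ) else 0) ≤ 1 := fun a => by
    rw [← Finset.sum_filter, Finset.sum_const, nsmul_eq_mul, mul_one]
    have : ((Finset.Icc 1 n).filter fun t => v t = a).card ≤ 1 :=
      Finset.card_le_one.2 fun s hs t ht => by
        simp only [Finset.mem_filter, Finset.mem_Icc] at hs ht
        exact node_injective hsel hs.1.1 ht.1.1 (hs.2.trans ht.2.symm)
    exact_mod_cast this
  have hcount : ∀ a, ∑ t ∈ Finset.Icc 1 n, (if v t ∈ descendants a then (1 : ℝ) else 0) =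
      count v n a := fun a => by
    rw [count, visits, Finset.card_filter]
    push_cast
    congr!
  calc n * fstar f - ∑ t ∈ Finset.Icc 1 n, f (x t)
      = ∑ t ∈ Finset.Icc 1 n, (fstar f - f (x t)) := by simp [Finset.sum_sub_distrib]
    _ ≤ ∑ t ∈ Finset.Icc 1 n, (4 * ν₁ * ρ ^ H + ∑ h ∈ Finset.range H, 4 * ν₁ * ρ ^ h *
          (∑ a ∈ nearOptimalNodes f R ν₁ ρ h, (if v t = a then 1 else 0) +
            ∑ a ∈ fringe f R ν₁ ρ h, if v t ∈ descendants a then 1 else 0)) :=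
        Finset.sum_le_sum fun t ht => fstar_sub_le_sum hR hA1 hA2 hν₁ hρ H
          (hvroot t (Finset.mem_Icc.1 ht).1) (hx t (Finset.mem_Icc.1 ht).1)
    _ = 4 * ν₁ * ρ ^ H * n + ∑ h ∈ Finset.range H, 4 * ν₁ * ρ ^ h *
          (∑ a ∈ nearOptimalNodes f R ν₁ ρ h, ∑ t ∈ Finset.Icc 1 n, (if v t = a then 1 else 0) +
            ∑ a ∈ fringe f R ν₁ ρ h, (count v n a : ℝ)) := by
        rw [Finset.sum_add_distrib, Finset.sum_comm]
        congr 1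
        · simp [mul_comm]
        · refine Finset.sum_congr rfl fun h _ => ?_
          rw [← Finset.mul_sum, Finset.sum_add_distrib, Finset.sum_comm]
          congr 2
          rw [Finset.sum_comm]
          exact Finset.sum_congr rfl fun a _ => hcount a
    _ ≤ _ := by
        gcongr with h _
        refine (Finset.sum_le_sum fun a _ => hone a).trans_eq (by simp)

end Decomposition

/-! ### Choice of the cut-off depth and the final rate -/

section Regret

variable {𝒳 : Type*} [MeasurableSpace 𝒳] {M : 𝒳 → ProbabilityMeasure ℝ} {R : ℕ → ℕ → Set 𝒳}
  {ℓ : 𝒳 → 𝒳 → ℝ} {ν₁ ρ ν₂ : ℝ}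

/-- The exponents of `n` and `ln n` in the regret bound come from the depth at which
`ρ ^ H = (ln n / n) ^ (1 / (d + 2))`. -/
theorem rate_identities {d n L : ℝ} (hd : 0 < d) (hn : 0 < n) (hL : 0 < L) :
    (L / n) ^ (1 / (d + 2)) * n = n ^ ((d + 1) / (d + 2)) * L ^ (1 / (d + 2)) ∧
    L * ((L / n) ^ (1 / (d + 2))) ^ (-(1 + d)) = (L / n) ^ (1 / (d + 2)) * n := by
  have hq : 0 < L / n := div_pos hL hn
  have hd2 : d + 2 ≠ 0 := by positivity
  constructor
  · rw [show (d + 1) / (d + 2) = 1 - 1 / (d + 2) by field_simp; ring, Real.rpow_sub hn,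
      Real.rpow_one, Real.div_rpow hL.le hn.le]
    ring
  · rw [← Real.rpow_mul hq.le,
      show 1 / (d + 2) * -(1 + d) = 1 / (d + 2) - 1 by field_simp; ring,
      Real.rpow_sub hq, Real.rpow_one]
    field_simp

/-- The sum is geometric with ratio `q` > 1, hence comparable to its last term. At ρ^H ≈ z that
term, of order ln n · z^(-(1+d)), equals z·n, the order of the first term. -/
theorem exists_depth_bound {ρ d A B : ℝ} (hρ : 0 < ρ) (hρ₁ : ρ < 1) (hd : 0 < d) (hA : 0 ≤ A)
    (hB : 0 ≤ B) :
    ∃ γ : ℝ, ∀ n : ℕ, 2 ≤ n → ∃ H : ℕ,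
      A * ρ ^ H * n + ∑ h ∈ Finset.range H, B * Real.log n * (ρ ^ h) ^ (-(1 + d)) ≤
        γ * (n : ℝ) ^ ((d + 1) / (d + 2)) * (Real.log n) ^ (1 / (d + 2)) := by
  set q := ρ ^ (-(1 + d)) with hq
  have hq1 : 1 < q := Real.one_lt_rpow_of_pos_of_lt_one_of_neg hρ hρ₁ (by linarith)
  have hqpow : ∀ h : ℕ, (ρ ^ h) ^ (-(1 + d)) = q ^ h := fun h => by
    rw [hq, ← Real.rpow_natCast, ← Real.rpow_natCast, ← Real.rpow_mul hρ.le, ← Real.rpow_mul hρ.le,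
      mul_comm]
  refine ⟨A + B * (q / (q - 1)), fun n hn => ?_⟩
  have hn1 : (1 : ℝ) < n := by exact_mod_cast hn
  have hn0 : (0 : ℝ) < n := by linarith
  have hL : 0 < Real.log n := Real.log_pos hn1
  obtain ⟨id1, id2⟩ := rate_identities hd hn0 hL
  set z := (Real.log n / n) ^ (1 / (d + 2)) with hz
  have hz0 : 0 < z := Real.rpow_pos_of_pos (div_pos hL hn0) _
  have hz1 : z ≤ 1 := Real.rpow_le_one (div_pos hL hn0).le
    ((div_le_one hn0).2 ((Real.log_le_sub_one_of_pos hn0).trans (by linarith))) (by positivity)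
  obtain ⟨m, hm1, hm2⟩ := exists_nat_pow_near_of_lt_one hz0 hz1 hρ hρ₁
  -- Here ρ^(m+1) < z ≤ ρ^m: the cut-off depth m+1 makes the first term small, while the deepest
  -- summand has depth only m.
  refine ⟨m + 1, ?_⟩
  have hsum : ∑ h ∈ Finset.range (m + 1), B * Real.log n * (ρ ^ h) ^ (-(1 + d)) ≤
      B * (q / (q - 1)) * (z * n) := by
    rw [← Finset.mul_sum, Finset.sum_congr rfl fun h _ => hqpow h, geom_sum_eq hq1.ne']
    have hq1' : 0 < q - 1 := by linarith
    have h1 : q ^ m ≤ z ^ (-(1 + d)) := by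
      rw [← hqpow m]
      exact Real.rpow_le_rpow_of_nonpos hz0 hm2 (by linarith)
    have h2 : (q ^ (m + 1) - 1) / (q - 1) ≤ q / (q - 1) * z ^ (-(1 + d)) := by
      rw [div_mul_eq_mul_div]
      gcongr
      rw [pow_succ']
      nlinarith
    calc _ ≤ B * Real.log n * (q / (q - 1) * z ^ (-(1 + d))) := by gcongr
      _ = B * (q / (q - 1)) * (Real.log n * z ^ (-(1 + d))) := by ring
      _ = _ := by rw [id2]
  calc _ ≤ A * z * n + B * (q / (q - 1)) * (z * n) := by gcongr
    _ = (A + B * (q / (q - 1))) * (z * n) := by ring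
    _ = _ := by rw [id1]; ring

variable {Ω : Type*} [MeasurableSpace Ω] {ℙ : Measure Ω} [IsProbabilityMeasure ℙ]
  {V : ℕ → Ω → Node} {X : ℕ → Ω → 𝒳} {Y : ℕ → Ω → ℝ}

theorem IsRun.integrable_regret (h : IsRun M R ν₁ ρ ℙ V X Y)
    (hM : ∀ x, (M x : Measure ℝ) (Set.Icc 0 1)ᶜ = 0) (hf : Measurable (meanPayoff M)) (n : ℕ) :
    Integrable (regret (meanPayoff M) X n) ℙ := by
  refine (integrable_const _).sub (integrable_finsetSum _ fun t ht => ?_)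
  exact Integrable.of_mem_Icc 0 1 (hf.comp (h.measurable_arm t (Finset.mem_Icc.1 ht).1)).aemeasurable
    (ae_of_all _ fun ω => meanPayoff_mem_Icc hM _)

/-- Each near-optimal node of depth k brings at most two fringe children, which are suboptimal at
the scale of their own depth k+1, so the visit bound applies to them. -/
theorem IsRun.integral_regret_le [Nonempty 𝒳] (h : IsRun M R ν₁ ρ ℙ V X Y)
    (hM : ∀ x, (M x : Measure ℝ) (Set.Icc 0 1)ᶜ = 0) (hf : Measurable (meanPayoff M))
    (hν₁ : 0 < ν₁) (hρ : 0 < ρ) (hR : IsTreeOfCoverings R)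
    (hA1 : ShrinksGeometrically R ℓ ν₁ ρ ν₂) (hA2 : WeaklyLipschitz (meanPayoff M) ℓ) (H n : ℕ) :
    ∫ ω, regret (meanPayoff M) X n ω ∂ℙ ≤ 4 * ν₁ * ρ ^ H * n +
      ∑ k ∈ Finset.range H, 4 * ν₁ * ρ ^ k * ((nearOptimalNodes (meanPayoff M) R ν₁ ρ k).card *
        (1 + 2 * (8 * Real.log n / (ν₁ * ρ ^ (k + 1)) ^ 2 + 1 +
          ∑' t : ℕ, 3 * (1 / (t : ℝ) ^ 2)))) := by
  set f := meanPayoff M with hfdef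
  have hsel : ∀ᵐ ω ∂ℙ, ∀ t, Selects ν₁ ρ (fun t => V t ω) (fun t => Y t ω) t (V (t + 1) ω) :=
    ae_all_iff.2 h.node_selected
  have harm : ∀ᵐ ω ∂ℙ, ∀ t, 1 ≤ t → X t ω ∈ R (V t ω).1 (V t ω).2 :=
    ae_all_iff.2 fun t => Filter.eventually_imp_distrib_left.2 (h.arm_mem t)
  have hint : ∀ k, Integrable (fun ω => ∑ a ∈ fringe f R ν₁ ρ k, (count (fun t => V t ω) n a : ℝ))
      ℙ := fun k => integrable_finsetSum _ fun a _ => h.integrable_count n a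
  have hint' : ∀ k, Integrable (fun ω => 4 * ν₁ * ρ ^ k * ((nearOptimalNodes f R ν₁ ρ k).card +
      ∑ a ∈ fringe f R ν₁ ρ k, (count (fun t => V t ω) n a : ℝ))) ℙ := fun k =>
    ((integrable_const _).add (hint k)).const_mul _
  calc ∫ ω, regret f X n ω ∂ℙ
      ≤ ∫ ω, (4 * ν₁ * ρ ^ H * n + ∑ k ∈ Finset.range H, 4 * ν₁ * ρ ^ k *
        ((nearOptimalNodes f R ν₁ ρ k).card +
          ∑ a ∈ fringe f R ν₁ ρ k, (count (fun t => V t ω) n a : ℝ))) ∂ℙ := by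
        refine integral_mono_ae (h.integrable_regret hM hf n)
          ((integrable_const _).add (integrable_finsetSum _ fun k _ => hint' k)) ?_
        filter_upwards [hsel, harm] with ω hsel harm
        exact regret_le_sum_count hR hA1 hA2 hν₁ hρ hsel harm H n
    _ = 4 * ν₁ * ρ ^ H * n + ∑ k ∈ Finset.range H, 4 * ν₁ * ρ ^ k *
        ((nearOptimalNodes f R ν₁ ρ k).card +
          ∑ a ∈ fringe f R ν₁ ρ k, ∫ ω, (count (fun t => V t ω) n a : ℝ) ∂ℙ) := by
        rw [integral_add (integrable_const _) (integrable_finsetSum _ fun k _ => hint' k),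
          integral_finsetSum _ fun k _ => hint' k]
        congr 1
        · simp
        · refine Finset.sum_congr rfl fun k _ => ?_
          rw [integral_const_mul, integral_add (integrable_const _) (hint k),
            integral_finsetSum _ fun a _ => h.integrable_count n a]
          simp
    _ ≤ _ := by
        gcongr with k _
        set c := 8 * Real.log n / (ν₁ * ρ ^ (k + 1)) ^ 2 + 1 + ∑' t : ℕ, 3 * (1 / (t : ℝ) ^ 2) with hc
        have hc0 : 0 ≤ c := by
          have h1 := Real.log_natCast_nonneg n
          have h2 : 0 ≤ ∑' t : ℕ, 3 * (1 / (t : ℝ) ^ 2) := tsum_nonneg fun t => by positivity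
          positivity
        have h1 : ∑ a ∈ fringe f R ν₁ ρ k, ∫ ω, (count (fun t => V t ω) n a : ℝ) ∂ℙ ≤
            (fringe f R ν₁ ρ k).card * c := by
          rw [← nsmul_eq_mul]
          refine Finset.sum_le_card_nsmul _ _ _ fun a ha => ?_
          obtain ⟨⟨p, hp, hpa⟩, hsub⟩ := mem_fringe.1 ha
          obtain ⟨rfl, hproot, -⟩ := mem_nearOptimalNodes.1 hp
          rw [← hpa.depth] at hsub hc
          exact hc ▸ h.integral_count_le hM hf hν₁ hρ hR hA1 hA2 (hpa.mem_descendants hproot) hsub n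
        have h2 : ((fringe f R ν₁ ρ k).card : ℝ) ≤ 2 * (nearOptimalNodes f R ν₁ ρ k).card := by
          exact_mod_cast card_fringe_le k
        nlinarith [mul_le_mul_of_nonneg_right h2 hc0]

/-- Combination of the expected number of visits of a fringe node and the number of near-optimal
nodes at depth `k`. -/
theorem depth_term_le {ρ ν C K d L N : ℝ} {k : ℕ} (hρ : 0 < ρ) (hρ₁ : ρ < 1) (hν : 0 < ν)
    (hC : 0 ≤ C) (hK : 0 ≤ K) (hL : Real.log 2 ≤ L) (hN : N ≤ K * (ρ ^ k) ^ (-d)) :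
    4 * ν * ρ ^ k * (N * (1 + 2 * (8 * L / (ν * ρ ^ (k + 1)) ^ 2 + 1 + C))) ≤
      4 * ν * K * ((3 + 2 * C) / Real.log 2 + 16 / (ν * ρ) ^ 2) * L * (ρ ^ k) ^ (-(1 + d)) := by
  have hlog2 : 0 < Real.log 2 := Real.log_pos one_lt_two
  have hL0 : 0 < L := hlog2.trans_le hL
  set w := ρ ^ k with hw
  have hw0 : 0 < w := pow_pos hρ k
  have hw1 : w ≤ 1 := pow_le_one₀ hρ.le hρ₁.le
  have hpow : w ^ (-(1 + d)) = w * w ^ (-d) / w ^ 2 := by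
    rw [neg_add, Real.rpow_add hw0, Real.rpow_neg_one]
    field_simp
  have h1 : 1 + 2 * (8 * L / (ν * ρ ^ (k + 1)) ^ 2 + 1 + C) ≤
      ((3 + 2 * C) / Real.log 2 + 16 / (ν * ρ) ^ 2) * L / w ^ 2 := by
    -- The constants are absorbed into the logarithmic term because L ≥ ln 2 and w ≤ 1; this is
    -- where n ≥ 2 enters.
    have h2 : 3 + 2 * C ≤ (3 + 2 * C) / Real.log 2 * L / w ^ 2 := by
      rw [le_div_iff₀ (by positivity), div_mul_eq_mul_div, le_div_iff₀ hlog2, mul_assoc]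
      refine mul_le_mul_of_nonneg_left ?_ (by positivity)
      have : w ^ 2 ≤ 1 := pow_le_one₀ hw0.le hw1
      nlinarith
    have h3 : 2 * (8 * L / (ν * ρ ^ (k + 1)) ^ 2) = 16 / (ν * ρ) ^ 2 * L / w ^ 2 := by
      rw [pow_succ ρ k, ← hw]
      field_simp
      norm_num
    rw [add_mul, add_div, ← h3]
    linarith
  calc 4 * ν * w * (N * (1 + 2 * (8 * L / (ν * ρ ^ (k + 1)) ^ 2 + 1 + C)))
      ≤ 4 * ν * w * (K * w ^ (-d) *
          (((3 + 2 * C) / Real.log 2 + 16 / (ν * ρ) ^ 2) * L / w ^ 2)) := by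
        gcongr
    _ = _ := by rw [hpow]; ring

end Regret

end HOO

theorem theorem1 {𝒳 : Type*} [MeasurableSpace 𝒳]
    -- the bandit environment
    (M : 𝒳 → ProbabilityMeasure ℝ)
    (hM : ∀ x, (M x : Measure ℝ) (Set.Icc 0 1)ᶜ = 0)
    (hf : Measurable (HOO.meanPayoff M))
    -- the parameters of HOO
    (ν₁ ρ : ℝ) (hν₁ : 0 < ν₁) (hρ₀ : 0 < ρ) (hρ₁ : ρ < 1)
    (R : ℕ → ℕ → Set 𝒳) (hR : HOO.IsTreeOfCoverings R)
    -- the two assumptions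
    (ℓ : 𝒳 → 𝒳 → ℝ) (hℓ : HOO.IsDissimilarity ℓ)
    (ν₂ : ℝ) (hν₂ : 0 < ν₂)
    (hA1 : HOO.ShrinksGeometrically R ℓ ν₁ ρ ν₂)
    (hA2 : HOO.WeaklyLipschitz (HOO.meanPayoff M) ℓ)
    (d' : ℝ)
    (hd' : HOO.nearOptimalityDimension (4 * ν₁ / ν₂) (HOO.meanPayoff M) ℓ < (d' : EReal)) :
    ∃ γ : ℝ, ∀ (Ω : Type*) [MeasurableSpace Ω] (ℙ : Measure Ω) [IsProbabilityMeasure ℙ]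
      (V : ℕ → Ω → HOO.Node) (X : ℕ → Ω → 𝒳) (Y : ℕ → Ω → ℝ),
      HOO.IsRun M R ν₁ ρ ℙ V X Y →
      ∀ n : ℕ, 2 ≤ n →
        Integrable (HOO.regret (HOO.meanPayoff M) X n) ℙ ∧
        ∫ ω, HOO.regret (HOO.meanPayoff M) X n ω ∂ℙ ≤
          γ * (n : ℝ) ^ ((d' + 1) / (d' + 2)) * (Real.log n) ^ (1 / (d' + 2)) := by
  obtain ⟨x₀, hx₀, -⟩ := hA1.2
  have : Nonempty 𝒳 := ⟨x₀ 0 1⟩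
  have hd0 : 0 < d' :=
    EReal.coe_pos.1 ((HOO.nearOptimalityDimension_nonneg (4 * ν₁ / ν₂) _ ℓ).trans_lt hd')
  obtain ⟨K, hK, hcard⟩ := HOO.exists_card_nearOptimalNodes_le hA1 hA2 hν₁ hρ₀ hρ₁ hν₂ hd'
  set C : ℝ := ∑' t : ℕ, 3 * (1 / (t : ℝ) ^ 2) with hC
  have hC0 : 0 ≤ C := tsum_nonneg fun t => by positivity
  have hlog2 : 0 < Real.log 2 := Real.log_pos one_lt_two
  -- The constant is fixed before any run is introduced, so it does not depend on tie-breaking or on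
  -- the choice of arms.
  obtain ⟨γ, hγ⟩ := HOO.exists_depth_bound (A := 4 * ν₁)
    (B := 4 * ν₁ * K * ((3 + 2 * C) / Real.log 2 + 16 / (ν₁ * ρ) ^ 2)) hρ₀ hρ₁ hd0
    (by positivity) (by positivity)
  refine ⟨γ, fun Ω _ ℙ _ V X Y hrun n hn => ⟨hrun.integrable_regret hM hf n, ?_⟩⟩
  obtain ⟨H, hH⟩ := hγ n hn
  refine (hrun.integral_regret_le hM hf hν₁ hρ₀ hR hA1 hA2 H n).trans (le_trans ?_ hH)
  refine add_le_add le_rfl (Finset.sum_le_sum fun k _ => ?_)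
  exact HOO.depth_term_le hρ₀ hρ₁ hν₁ hC0 hK
    (Real.log_le_log two_pos (Nat.ofNat_le_cast.2 hn)) (hcard k)
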